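/- **Proposition (conservation of mass, balance of momentum).** Let $d\ge 1$ (in applications $d=1,2,3$), let $\Omega\subset\mathbb R^d$ be a bounded domain with Lipschitz boundary, with outward unit normal $\mathbf n$ (defined a.e. on $\partial\Omega$), and let $T>0$. Let $\rho_1,\rho_2,\gamma,\eta,m_j,m_r>0$ be constants and $W\in C^2(\mathbb R)$ a potential (for example a double well). Put $$\rho(\phi)=\tfrac12\big[\rho_1(1+\phi)+\rho_2(1-\phi)\big],\quad c_\pm=\frac1{\rho_1}\pm\frac1{\rho_2},\quad \mu(\phi)=W'(\phi)-\gamma\Delta\phi,\quad p(\phi)=\phi W'(\phi)-W(\phi),$$ and $q=c_+\mu(\phi)+c_-\lambda$. Let $(\phi,\mathbf v,\lambda)$ be a strong solution on $(0,T)\times\Omega$ of $$\partial_t\phi+\operatorname{div}(\phi\mathbf v)=c_+(m_j\Delta-m_r)q,$$ $$\rho(\phi)\big(\partial_t\mathbf v+(\mathbf v\cdot\nabla)\mathbf v\big)+\nabla(p(\phi)+\lambda)=\eta\Delta\mathbf v+\gamma\,\phi\nabla\Delta\phi,$$ $$\operatorname{div}\mathbf v=c_-(m_j\Delta-m_r)q,$$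 with the boundary conditions $\nabla\phi\cdot\mathbf n=0$, $\mathbf v=\mathbf 0$, $\nabla q\cdot\mathbf n=0$ on $\partial\Omega$. Here "strong solution" means that the equations hold pointwise in $(0,T)\times\Omega$, that for each $t\in(0,T)$ one has $\phi(t)\in C^3(\overline\Omega)$, $\mathbf v(t)\in C^2(\overline\Omega)^d$, $\lambda(t)\in C^1(\overline\Omega)$, $q(t)\in C^2(\overline\Omega)$, and that $\partial_t\phi$, $\partial_t\mathbf v$ exist and are continuous on $(0,T)\times\overline\Omega$. Then for every $t\in(0,T)$ the integrals below converge absolutely, the derivatives exist, and $$\frac{d}{dt}\int_\Omega\rho(\phi)\,dx=0,$$ $$\frac{d}{dt}\int_\Omega\rho(\phi)\,\mathbf v\,dx=-\int_{\partial\Omega}\Big[\big(p(\phi)+\lambda-\gamma\,\phi\Delta\phi-\tfrac{\gamma}{2}|\nabla\phi|^2\big)\mathbf n-\eta\,(D\mathbf v)\,\mathbf n\Big]\,dS,$$ where $D\mathbf v$ is the Jacobian matrix of $\mathbf v$ and $dS$ is the surface measure. -/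

import Mathlib

open Set MeasureTheory

noncomputable section

namespace QuasiIncompressible

/-! ### Lipschitz domains, outward normal, surface measure -/

/-- Euclidean space `ℝ^d`. -/
abbrev Space (d : ℕ) : Type := EuclideanSpace ℝ (Fin d)

/-- `Ω ⊆ ℝ^d` has a Lipschitz boundary: near each boundary point there are orthonormal coordinates
`(y, s) ∈ ℝ^(d-1) × ℝ`, given by a linear isometry `R`, in which `Ω` is the strict subgraph
`s < g y` of a Lipschitz function `g`. -/
def HasLipschitzBoundary {d : ℕ} (Ω : Set (Space d)) : Prop :=
  ∀ x₀ ∈ frontier Ω, ∃ U : Set (Space d), IsOpen U ∧ x₀ ∈ U ∧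
    ∃ (R : Space d ≃ₗᵢ[ℝ] WithLp 2 (Space (d - 1) × ℝ)) (g : Space (d - 1) → ℝ) (K : NNReal),
      LipschitzWith K g ∧ Ω ∩ U = {x | x ∈ U ∧ (R x).snd < g (R x).fst}

/-- A bounded domain (nonempty, connected, open) with Lipschitz boundary. -/
structure IsBoundedLipschitzDomain {d : ℕ} (Ω : Set (Space d)) : Prop where
  isOpen : IsOpen Ω
  isConnected : IsConnected Ω
  isBounded : Bornology.IsBounded Ω
  lipschitz : HasLipschitzBoundary Ω

/-- `ν` is the outward unit normal of `Ω` at `x`: up to an error `o(|z - x|)`, the set `Ω` is near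
`x` the half-space `⟪z - x, ν⟫ < 0`. -/
def IsOuterNormal {d : ℕ} (Ω : Set (Space d)) (x ν : Space d) : Prop :=
  ‖ν‖ = 1 ∧ ∀ ε > (0 : ℝ), ∃ δ > (0 : ℝ), ∀ z : Space d, ‖z - x‖ < δ →
    (inner ℝ (z - x) ν < -(ε * ‖z - x‖) → z ∈ Ω) ∧
    (ε * ‖z - x‖ < inner ℝ (z - x) ν → z ∉ Ω)

/-- The outward unit normal is unique where it exists. -/
theorem IsOuterNormal.unique {d : ℕ} {Ω : Set (Space d)} {x ν ν' : Space d}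
    (h : IsOuterNormal Ω x ν) (h' : IsOuterNormal Ω x ν') : ν = ν' := by
  by_contra hne
  set w : Space d := ν' - ν with hw
  have hw0 : 0 < ‖w‖ := norm_pos_iff.2 (sub_ne_zero.2 (Ne.symm hne))
  have hn : inner ℝ ν ν = (1 : ℝ) := by rw [real_inner_self_eq_norm_sq, h.1]; norm_num
  have hn' : inner ℝ ν' ν' = (1 : ℝ) := by rw [real_inner_self_eq_norm_sq, h'.1]; norm_num
  have hsq : ‖w‖ ^ 2 = 2 - 2 * inner ℝ ν' ν := by
    rw [hw, norm_sub_sq_real, h.1, h'.1]; ring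
  have h1 : inner ℝ w ν = -(‖w‖ ^ 2 / 2) := by
    rw [hsq, hw, inner_sub_left, hn]; ring
  have h2 : inner ℝ w ν' = ‖w‖ ^ 2 / 2 := by
    rw [hsq, hw, inner_sub_left, hn', real_inner_comm]; ring
  have hε : 0 < ‖w‖ / 4 := by positivity
  obtain ⟨δ, hδ, H⟩ := h.2 _ hε
  obtain ⟨δ', hδ', H'⟩ := h'.2 _ hε
  set c : ℝ := min δ δ' / (2 * ‖w‖) with hc
  have hm : 0 < min δ δ' := lt_min hδ hδ'
  have hc0 : 0 < c := by positivity
  have hnorm : ‖(x + c • w) - x‖ = c * ‖w‖ := by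
    rw [add_sub_cancel_left, norm_smul, Real.norm_of_nonneg hc0.le]
  have hlt : c * ‖w‖ < min δ δ' := by
    have : c * ‖w‖ = min δ δ' / 2 := by rw [hc]; field_simp
    linarith
  have hp : 0 < c * ‖w‖ ^ 2 := by positivity
  refine (H' (x + c • w) ?_).2 ?_ ((H (x + c • w) ?_).1 ?_)
  · rw [hnorm]; exact hlt.trans_le (min_le_right _ _)
  · rw [hnorm, add_sub_cancel_left, inner_smul_left, h2]
    simp only [conj_trivial]; nlinarith
  · rw [hnorm]; exact hlt.trans_le (min_le_left _ _)
  · rw [hnorm, add_sub_cancel_left, inner_smul_left, h1]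
    simp only [conj_trivial]; nlinarith

open Classical in
/-- The outward unit normal field `n` on `∂Ω`; it exists at almost every boundary point of a
Lipschitz domain, and is set to `0` where it does not exist. -/
def outerNormal {d : ℕ} (Ω : Set (Space d)) (x : Space d) : Space d :=
  if h : ∃ ν, IsOuterNormal Ω x ν then h.choose else 0

/-- The surface measure on `∂Ω`: the `(d-1)`-dimensional Hausdorff measure, normalised so that it is
Lebesgue measure on `ℝ^(d-1)`, restricted to the boundary. -/
def surfaceMeasure {d : ℕ} (Ω : Set (Space d)) : Measure (Space d) :=
  (Measure.euclideanHausdorffMeasure (d - 1)).restrict (frontier Ω)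

/-! ### Differential operators up to the boundary

Derivatives are taken within `closure Ω`: in `Ω` they are the ordinary ones, on `∂Ω` they are the
boundary values of the derivatives of a function of class `C^k` up to the boundary. -/

/-- The spatial gradient `∇ f`. -/
abbrev grad {d : ℕ} (Ω : Set (Space d)) (f : Space d → ℝ) (x : Space d) : Space d :=
  gradientWithin f (closure Ω) x

/-- The Jacobian `D F` of a vector field. -/
abbrev jacobian {d : ℕ} (Ω : Set (Space d)) (F : Space d → Space d) (x : Space d) :
    Space d →L[ℝ] Space d :=
  fderivWithin ℝ F (closure Ω) x

/-- The divergence `∑ i, ∂ᵢ Fᵢ` of a vector field. -/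
def dvg {d : ℕ} (Ω : Set (Space d)) (F : Space d → Space d) (x : Space d) : ℝ :=
  ∑ i, (jacobian Ω F x (EuclideanSpace.single i 1)) i

/-- The Laplacian of a scalar function, or componentwise of a vector field. -/
abbrev lapl {d : ℕ} {F : Type*} [NormedAddCommGroup F] [NormedSpace ℝ F]
    (Ω : Set (Space d)) (f : Space d → F) (x : Space d) : F :=
  InnerProductSpace.laplacianWithin f (closure Ω) x

/-! ### The model -/

/-- The constants and the potential of the model. -/
structure Parameters where
  /-- densities of the two constituents -/
  ρ₁ : ℝ
  ρ₂ : ℝ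
  /-- capillarity constant -/
  γ : ℝ
  /-- viscosity -/
  η : ℝ
  /-- mobilities -/
  mj : ℝ
  mr : ℝ
  /-- the potential -/
  W : ℝ → ℝ
  ρ₁_pos : 0 < ρ₁
  ρ₂_pos : 0 < ρ₂
  γ_pos : 0 < γ
  η_pos : 0 < η
  mj_pos : 0 < mj
  mr_pos : 0 < mr
  W_contDiff : ContDiff ℝ 2 W

namespace Parameters

variable (P : Parameters)

/-- Total density of the mixture at phase fraction `u`. -/
def ρ (u : ℝ) : ℝ := (1 / 2) * (P.ρ₁ * (1 + u) + P.ρ₂ * (1 - u))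

/-- `c₊ = 1/ρ₁ + 1/ρ₂`. -/
def cPlus : ℝ := 1 / P.ρ₁ + 1 / P.ρ₂

/-- `c₋ = 1/ρ₁ - 1/ρ₂`. -/
def cMinus : ℝ := 1 / P.ρ₁ - 1 / P.ρ₂

/-- The pressure `p(u) = u W'(u) - W(u)`. -/
def p (u : ℝ) : ℝ := u * deriv P.W u - P.W u

/-- The chemical potential `μ(φ) = W'(φ) - γ Δ φ`. -/
def μ {d : ℕ} (Ω : Set (Space d)) (φ : Space d → ℝ) (x : Space d) : ℝ :=
  deriv P.W (φ x) - P.γ * lapl Ω φ x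

/-- The combination `c₊ μ(φ) + c₋ λ`. -/
def q {d : ℕ} (Ω : Set (Space d)) (φ lam : Space d → ℝ) (x : Space d) : ℝ :=
  P.cPlus * P.μ Ω φ x + P.cMinus * lam x

end Parameters

/-- `(φ, v, λ)` is a strong solution on the time interval `(0, T)`: all derivatives that occur in the
system exist and are continuous up to the boundary, and the three equations hold pointwise. -/
structure IsStrongSolution {d : ℕ} (P : Parameters) (Ω : Set (Space d)) (T : ℝ)
    (φ : ℝ → Space d → ℝ) (v : ℝ → Space d → Space d) (lam : ℝ → Space d → ℝ) : Prop where
  φ_space : ∀ t ∈ Ioo 0 T, ContDiffOn ℝ 3 (φ t) (closure Ω)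
  v_space : ∀ t ∈ Ioo 0 T, ContDiffOn ℝ 2 (v t) (closure Ω)
  lam_space : ∀ t ∈ Ioo 0 T, ContDiffOn ℝ 1 (lam t) (closure Ω)
  q_space : ∀ t ∈ Ioo 0 T, ContDiffOn ℝ 2 (P.q Ω (φ t) (lam t)) (closure Ω)
  φ_time : ∀ x ∈ closure Ω, DifferentiableOn ℝ (fun t => φ t x) (Ioo 0 T)
  v_time : ∀ x ∈ closure Ω, DifferentiableOn ℝ (fun t => v t x) (Ioo 0 T)
  φ_time_cont : ContinuousOn (fun z : ℝ × Space d => deriv (fun t => φ t z.2) z.1)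
    (Ioo 0 T ×ˢ closure Ω)
  v_time_cont : ContinuousOn (fun z : ℝ × Space d => deriv (fun t => v t z.2) z.1)
    (Ioo 0 T ×ˢ closure Ω)
  phase_eq : ∀ t ∈ Ioo 0 T, ∀ x ∈ Ω,
    deriv (fun s => φ s x) t + dvg Ω (fun y => φ t y • v t y) x
      = P.cPlus * (P.mj * lapl Ω (P.q Ω (φ t) (lam t)) x - P.mr * P.q Ω (φ t) (lam t) x)
  momentum_eq : ∀ t ∈ Ioo 0 T, ∀ x ∈ Ω,
    P.ρ (φ t x) • (deriv (fun s => v s x) t + jacobian Ω (v t) x (v t x))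
        + grad Ω (fun y => P.p (φ t y) + lam t y) x
      = P.η • lapl Ω (v t) x + (P.γ * φ t x) • grad Ω (fun y => lapl Ω (φ t) y) x
  divergence_eq : ∀ t ∈ Ioo 0 T, ∀ x ∈ Ω,
    dvg Ω (v t) x
      = P.cMinus * (P.mj * lapl Ω (P.q Ω (φ t) (lam t)) x - P.mr * P.q Ω (φ t) (lam t) x)

/-- The boundary conditions `∇ φ · n = 0`, `v = 0` and `∇ (c₊ μ(φ) + c₋ λ) · n = 0` on `∂Ω`
(the first and the third wherever the normal `n` exists). -/
structure SatisfiesBoundaryConditions {d : ℕ} (P : Parameters) (Ω : Set (Space d)) (T : ℝ)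
    (φ : ℝ → Space d → ℝ) (v : ℝ → Space d → Space d) (lam : ℝ → Space d → ℝ) : Prop where
  φ_bc : ∀ t ∈ Ioo 0 T, ∀ x ∈ frontier Ω, inner ℝ (grad Ω (φ t) x) (outerNormal Ω x) = 0
  v_bc : ∀ t ∈ Ioo 0 T, ∀ x ∈ frontier Ω, v t x = 0
  q_bc : ∀ t ∈ Ioo 0 T, ∀ x ∈ frontier Ω,
    inner ℝ (grad Ω (P.q Ω (φ t) (lam t)) x) (outerNormal Ω x) = 0

/-- The boundary density
`(p(φ) + λ - γ φ Δφ - (γ/2) |∇φ|²) n - η (Dv) n` of the momentum flux. -/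
def momentumFlux {d : ℕ} (P : Parameters) (Ω : Set (Space d))
    (φ : Space d → ℝ) (v : Space d → Space d) (lam : Space d → ℝ) (x : Space d) : Space d :=
  (P.p (φ x) + lam x - P.γ * (φ x * lapl Ω φ x) - P.γ / 2 * ‖grad Ω φ x‖ ^ 2) • outerNormal Ω x
    - P.η • jacobian Ω v x (outerNormal Ω x)

end QuasiIncompressible

end

open Set MeasureTheory Filter Topology
open scoped NNReal ENNReal ContDiff

noncomputable section

namespace QuasiIncompressible

/-! Both laws come from integrating a pointwise divergence identity over `Ω`. Since `ρ(φ)` is affine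
in `φ`, a fixed combination of the phase equation and the divergence equation has source
proportional to `(ρ₁ - ρ₂) c₊ + (ρ₁ + ρ₂) c₋ = 0`; this is the continuity equation `∂ₜρ + div (ρ v)
= 0` (`mass_balance`). Combined with it, the momentum equation takes the conservative form `∂ₜ(ρ v)
= -div (ρ v ⊗ v) - div G` (`momentum_balance`). Here `G` contains the Korteweg stress `γ ∇φ ⊗ ∇φ`,
and the identity `div (∇φ ⊗ ∇φ) = Δφ ∇φ + ∇(|∇φ|²/2)` turns `γ φ ∇Δφ` into a divergence
(`sum_fderivWithin_momentumTensor`). On the boundary `v = 0` removes the convective fluxes, and `∇φ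
· n = 0` removes the normal component of the Korteweg stress, which leaves the stated flux.

The analytic weight lies in the Gauss–Green formula for functions that are `C¹` up to a Lipschitz
boundary (`integral_fderivWithin`). A partition of unity reduces it to functions supported inside
`Ω` or in one boundary chart. Below a graph, `integral_subgraph_fderiv` splits a derivative into a
part tangent to the translated graphs, which integrates to zero, and a vertical part, which is
integrated by the fundamental theorem of calculus. The result is an integral over the base, and the
area formula `comap_graphParam` identifies it with one against Hausdorff measure.

The time derivative passes under the integral by domination (`hasDerivAt_integral`), with bounds
from `exists_local_bound`. -/

/-! ### Surface measure of a Lipschitz graph -/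

/-- The linear map `y ↦ y + (1 + √(1 + ‖a‖²))⁻¹ ⟪a, y⟫ a`, which has the same metric distortion as
the parametrisation `y ↦ (y, ⟪a, y⟫)` of a hyperplane. -/
def graphStretch {m : ℕ} (a : Space m) : Space m →ₗ[ℝ] Space m :=
  LinearMap.id + (innerₛₗ ℝ a).smulRight ((1 + √(1 + ‖a‖ ^ 2))⁻¹ • a)

theorem graphStretch_apply {m : ℕ} (a y : Space m) :
    graphStretch a y = y + (inner ℝ a y * (1 + √(1 + ‖a‖ ^ 2))⁻¹) • a := by
  simp [graphStretch, smul_smul]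

/-- The coefficient `c = (1 + √(1 + ‖a‖²))⁻¹` is chosen to solve `2c + c²‖a‖² = 1`. -/
theorem norm_graphStretch_sq {m : ℕ} (a y : Space m) :
    ‖graphStretch a y‖ ^ 2 = ‖y‖ ^ 2 + (inner ℝ a y) ^ 2 := by
  have hJ : √(1 + ‖a‖ ^ 2) ^ 2 = 1 + ‖a‖ ^ 2 := Real.sq_sqrt (by positivity)
  have hJ0 : 0 ≤ √(1 + ‖a‖ ^ 2) := Real.sqrt_nonneg _
  rw [graphStretch_apply, norm_add_sq_real, norm_smul, inner_smul_right, mul_pow, Real.norm_eq_abs,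
    sq_abs, real_inner_comm a y]
  set J := √(1 + ‖a‖ ^ 2)
  have ha : ‖a‖ ^ 2 = J ^ 2 - 1 := by linarith
  rw [ha]
  have : 1 + J ≠ 0 := by positivity
  field_simp
  ring

/-- A rank-one perturbation of the identity has determinant `1 + c‖a‖²`, and `‖a‖² = J² - 1` with `J
= √(1 + ‖a‖²)` makes this `J`. So the area factor of a hyperplane is an honest determinant on the
base space. -/
theorem det_graphStretch {m : ℕ} (a : Space m) :
    LinearMap.det (graphStretch a) = √(1 + ‖a‖ ^ 2) := by
  have hJ : √(1 + ‖a‖ ^ 2) ^ 2 = 1 + ‖a‖ ^ 2 := Real.sq_sqrt (by positivity)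
  have hJ0 : 0 ≤ √(1 + ‖a‖ ^ 2) := Real.sqrt_nonneg _
  set c := (1 + √(1 + ‖a‖ ^ 2))⁻¹ with hc
  have key : LinearMap.toMatrix (EuclideanSpace.basisFun (Fin m) ℝ).toBasis
      (EuclideanSpace.basisFun (Fin m) ℝ).toBasis (graphStretch a)
      = 1 + Matrix.replicateCol Unit (fun i => c * a i) * Matrix.replicateRow Unit (fun i => a i) := by
    ext i j
    simp [LinearMap.toMatrix_apply, graphStretch_apply, Matrix.mul_apply, Matrix.one_apply,
      EuclideanSpace.inner_single_right, ← hc]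
    ring
  rw [← LinearMap.det_toMatrix (EuclideanSpace.basisFun (Fin m) ℝ).toBasis, key,
    Matrix.det_one_add_replicateCol_mul_replicateRow]
  have hs : (fun i => a i) ⬝ᵥ (fun i => c * a i) = c * ‖a‖ ^ 2 := by
    rw [EuclideanSpace.norm_sq_eq, dotProduct, Finset.mul_sum]
    refine Finset.sum_congr rfl fun i _ => ?_
    rw [Real.norm_eq_abs, sq_abs]; ring
  rw [hs, hc]
  set J := √(1 + ‖a‖ ^ 2)
  have ha : ‖a‖ ^ 2 = J ^ 2 - 1 := by linarith
  rw [ha]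
  have : 1 + J ≠ 0 := by positivity
  field_simp
  ring

/-- If `f` expands distances at most `K` times as much as `h`, the same holds for the measure of
images, with the factor `K ^ m`. -/
theorem euclideanHausdorffMeasure_image_le_of_edist_le {α X Y : Type*}
    [EMetricSpace X] [MeasurableSpace X] [BorelSpace X]
    [EMetricSpace Y] [MeasurableSpace Y] [BorelSpace Y] [Nonempty α]
    {f : α → X} {h : α → Y} {s : Set α} {K : ℝ≥0}
    (hK : ∀ x ∈ s, ∀ y ∈ s, edist (f x) (f y) ≤ K * edist (h x) (h y)) (m : ℕ) :
    Measure.euclideanHausdorffMeasure m (f '' s)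
      ≤ (K : ℝ≥0∞) ^ m * Measure.euclideanHausdorffMeasure m (h '' s) := by
  classical
  have hinv : ∀ x ∈ s, Function.invFunOn h s (h x) ∈ s ∧ h (Function.invFunOn h s (h x)) = h x :=
    fun x hx => ⟨Function.invFunOn_mem ⟨x, hx, rfl⟩, Function.invFunOn_eq ⟨x, hx, rfl⟩⟩
  have hlip : LipschitzOnWith K (f ∘ Function.invFunOn h s) (h '' s) := by
    rintro _ ⟨x, hx, rfl⟩ _ ⟨y, hy, rfl⟩
    have := hK _ (hinv x hx).1 _ (hinv y hy).1
    rwa [(hinv x hx).2, (hinv y hy).2] at this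
  -- The chosen preimage of `h x` may differ from `x`, but `h` agrees at the two points, so the
  -- distance bound forces `f` to agree as well.
  have himg : f '' s ⊆ (f ∘ Function.invFunOn h s) '' (h '' s) := by
    rintro _ ⟨x, hx, rfl⟩
    refine ⟨h x, ⟨x, hx, rfl⟩, ?_⟩
    have := hK _ (hinv x hx).1 _ hx
    rw [(hinv x hx).2, edist_self, mul_zero, nonpos_iff_eq_zero, edist_eq_zero] at this
    exact this
  have h1 := (measure_mono himg).trans (hlip.hausdorffMeasure_image_le (d := m) (by positivity))
  rw [ENNReal.rpow_natCast] at h1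
  rw [Measure.euclideanHausdorffMeasure_def, Measure.euclideanHausdorffMeasure_def,
    Measure.smul_apply, Measure.smul_apply, ENNReal.smul_def, ENNReal.smul_def, smul_eq_mul,
    smul_eq_mul, mul_left_comm]
  gcongr

variable {m d : ℕ}

/-- The parametrisation `y ↦ R⁻¹ (y, g y)` of a graph in rotated coordinates. -/
def graphParam (R : Space d ≃ₗᵢ[ℝ] WithLp 2 (Space m × ℝ)) (g : Space m → ℝ) (y : Space m) :
    Space d :=
  R.symm (WithLp.toLp 2 (y, g y))

/-- The area density `√(1 + ‖∇ g‖²)` of a graph. -/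
def graphDensity (g : Space m → ℝ) (y : Space m) : ℝ := √(1 + ‖fderiv ℝ g y‖ ^ 2)

theorem norm_graphParam_sub_sq (R : Space d ≃ₗᵢ[ℝ] WithLp 2 (Space m × ℝ)) (g : Space m → ℝ)
    (y y' : Space m) :
    ‖graphParam R g y - graphParam R g y'‖ ^ 2 = ‖y - y'‖ ^ 2 + (g y - g y') ^ 2 := by
  rw [graphParam, graphParam, ← map_sub, LinearIsometryEquiv.norm_map, WithLp.prod_norm_sq_eq_of_L2]
  simp

theorem volume_image_graphStretch (a : Space m) (s : Set (Space m)) :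
    Measure.euclideanHausdorffMeasure m (graphStretch a '' s)
      = ENNReal.ofReal (√(1 + ‖a‖ ^ 2)) * volume s := by
  rw [EuclideanSpace.euclideanHausdorffMeasure_eq_volume, Measure.addHaar_image_linearMap,
    det_graphStretch, abs_of_nonneg (Real.sqrt_nonneg _)]

/-- Think of `p` and `q` as the lengths of `(r, a)` and `(r, b)`: the triangle inequality gives `p ≤
q + |a - b| ≤ q + e r`, and `r ≤ q`. -/
theorem norm_le_add_of_sq_eq {p q r a b e : ℝ} (hq : 0 ≤ q)
    (hpe : p ^ 2 = r ^ 2 + a ^ 2) (hqe : q ^ 2 = r ^ 2 + b ^ 2) (hab : |a - b| ≤ e * r)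
    (he : 0 ≤ e) : p ≤ (1 + e) * q := by
  have hrq : r ≤ q := abs_le_of_sq_le_sq' (by nlinarith) hq |>.2
  have hbq : |b| ≤ q := abs_le_of_sq_le_sq (by nlinarith) hq
  have hab' : |a - b| ≤ e * q := hab.trans (by gcongr)
  obtain ⟨h1, h2⟩ := abs_le.1 hab'
  obtain ⟨h3, h4⟩ := abs_le.1 hbq
  refine abs_le_of_sq_le_sq' ?_ (by positivity) |>.2
  have h5 : (a - b) * b ≤ e * q * q := by
    calc (a - b) * b ≤ |(a - b) * b| := le_abs_self _
      _ = |a - b| * |b| := abs_mul _ _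
      _ ≤ e * q * q := by gcongr
  have h6 : (a - b) ^ 2 ≤ (e * q) ^ 2 := sq_le_sq' h1 h2
  nlinarith

/-- Squared distances on the two sides are `‖x - y‖²` plus the square of `g x - g y`, respectively
of `⟪a, x - y⟫`, and these increments differ by at most `ε‖x - y‖`. -/
theorem edist_graphParam_le (R : Space d ≃ₗᵢ[ℝ] WithLp 2 (Space m × ℝ)) {g : Space m → ℝ}
    {a : Space m} {s : Set (Space m)} {ε : ℝ≥0}
    (h : ApproximatesLinearOn g (innerSL ℝ a) s ε) :
    (∀ x ∈ s, ∀ y ∈ s, edist (graphParam R g x) (graphParam R g y)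
      ≤ (1 + ε : ℝ≥0) * edist (graphStretch a x) (graphStretch a y)) ∧
    (∀ x ∈ s, ∀ y ∈ s, edist (graphStretch a x) (graphStretch a y)
      ≤ (1 + ε : ℝ≥0) * edist (graphParam R g x) (graphParam R g y)) := by
  have key : ∀ x ∈ s, ∀ y ∈ s, |(g x - g y) - inner ℝ a (x - y)| ≤ ε * ‖x - y‖ := by
    intro x hx y hy
    simpa using h x hx y hy
  constructor <;> intro x hx y hy
  · rw [edist_dist, edist_dist, dist_eq_norm, dist_eq_norm, ← ENNReal.ofReal_coe_nnreal,
      ← ENNReal.ofReal_mul (by positivity), ← map_sub]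
    refine ENNReal.ofReal_le_ofReal ?_
    push_cast
    exact norm_le_add_of_sq_eq (norm_nonneg _)
      (norm_graphParam_sub_sq R g x y) (norm_graphStretch_sq a (x - y)) (key x hx y hy) ε.2
  · rw [edist_dist, edist_dist, dist_eq_norm, dist_eq_norm, ← ENNReal.ofReal_coe_nnreal,
      ← ENNReal.ofReal_mul (by positivity), ← map_sub]
    refine ENNReal.ofReal_le_ofReal ?_
    push_cast
    refine norm_le_add_of_sq_eq (norm_nonneg _)
      (norm_graphStretch_sq a (x - y)) (norm_graphParam_sub_sq R g x y) ?_ ε.2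
    rw [abs_sub_comm]
    exact key x hx y hy

theorem continuous_graphParam (R : Space d ≃ₗᵢ[ℝ] WithLp 2 (Space m × ℝ)) {g : Space m → ℝ}
    (hg : Continuous g) : Continuous (graphParam R g) := by
  unfold graphParam
  fun_prop

theorem antilipschitz_graphParam (R : Space d ≃ₗᵢ[ℝ] WithLp 2 (Space m × ℝ)) (g : Space m → ℝ) :
    AntilipschitzWith 1 (graphParam R g) := by
  refine AntilipschitzWith.of_le_mul_dist fun x y => ?_
  rw [dist_eq_norm, dist_eq_norm, NNReal.coe_one, one_mul]
  refine abs_le_of_sq_le_sq' ?_ (norm_nonneg _) |>.2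
  rw [norm_graphParam_sub_sq]
  nlinarith [sq_nonneg (g x - g y)]

theorem measurableEmbedding_graphParam (R : Space d ≃ₗᵢ[ℝ] WithLp 2 (Space m × ℝ))
    {g : Space m → ℝ} (hg : Continuous g) : MeasurableEmbedding (graphParam R g) :=
  (continuous_graphParam R hg).measurableEmbedding (antilipschitz_graphParam R g).injective

theorem lipschitz_graphParam (R : Space d ≃ₗᵢ[ℝ] WithLp 2 (Space m × ℝ)) {g : Space m → ℝ}
    {K : ℝ≥0} (hg : LipschitzWith K g) : LipschitzWith (1 + K) (graphParam R g) := by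
  refine LipschitzWith.of_dist_le_mul fun x y => ?_
  rw [dist_eq_norm, dist_eq_norm]
  push_cast
  refine norm_le_add_of_sq_eq (b := 0) (norm_nonneg _)
    (norm_graphParam_sub_sq R g x y) (by ring) ?_ K.2
  rw [sub_zero, ← Real.norm_eq_abs]
  exact hg.norm_sub_le x y

theorem graphDensity_nonneg (g : Space m → ℝ) (y : Space m) : 0 ≤ graphDensity g y :=
  Real.sqrt_nonneg _

theorem one_le_graphDensity (g : Space m → ℝ) (y : Space m) : 1 ≤ graphDensity g y := by
  rw [graphDensity, Real.one_le_sqrt]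
  nlinarith [sq_nonneg ‖fderiv ℝ g y‖]

theorem measurable_graphDensity (g : Space m → ℝ) : Measurable (graphDensity g) := by
  unfold graphDensity
  have := measurable_fderiv ℝ g
  fun_prop

theorem sqrt_one_add_sq_le {a b e : ℝ} (ha : 0 ≤ a) (he : 0 ≤ e) (h : a ≤ b + e) :
    √(1 + a ^ 2) ≤ (1 + e) * √(1 + b ^ 2) := by
  have hs : √(1 + b ^ 2) ^ 2 = 1 + b ^ 2 := Real.sq_sqrt (by positivity)
  refine Real.sqrt_le_iff.2 ⟨by positivity, ?_⟩
  rw [mul_pow, hs]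
  nlinarith [mul_nonneg he (sq_nonneg (2 * b - 1)), mul_nonneg (sq_nonneg e) (sq_nonneg b),
    mul_self_le_mul_self ha h]

/-- Localisation principle: after the cover is made disjoint, countable additivity sums the
estimates. The hypothesis covers all measurable subsets of a piece so that it survives this, and so
that two covers can be nested. -/
theorem measure_le_mul_of_subset_iUnion {α : Type*} [MeasurableSpace α] {μ ν : Measure α}
    {c : ℝ≥0∞} {B : Set α} {P : ℕ → Set α} (hB : MeasurableSet B)
    (hP : ∀ k, MeasurableSet (P k)) (hBP : B ⊆ ⋃ k, P k)
    (h : ∀ k, ∀ A ⊆ B ∩ P k, MeasurableSet A → ν A ≤ c * μ A) : ν B ≤ c * μ B := by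
  have hd : Pairwise (Function.onFun Disjoint fun k => B ∩ disjointed P k) := fun i j hij =>
    (disjoint_disjointed P hij).mono inter_subset_right inter_subset_right
  have hm : ∀ k, MeasurableSet (B ∩ disjointed P k) := fun k =>
    hB.inter (MeasurableSet.disjointed hP k)
  have hU : B = ⋃ k, B ∩ disjointed P k := by
    rw [← inter_iUnion, iUnion_disjointed, inter_eq_left.2 hBP]
  rw [hU, measure_iUnion hd hm, measure_iUnion hd hm, ← ENNReal.tsum_mul_left]
  exact ENNReal.tsum_le_tsum fun k =>
    h k _ (inter_subset_inter_right _ (disjointed_subset P k)) (hm k)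

/-! ### The area formula, by linearisation on small pieces -/

section AreaFormula

variable (R : Space d ≃ₗᵢ[ℝ] WithLp 2 (Space m × ℝ)) {g : Space m → ℝ}

/-- Both quantities are compared with `√(1 + ‖a‖²) * volume s`, the measure of the image under
`graphStretch a`. Distances cost the factor `(1 + ε) ^ m`, and replacing the varying density by a
constant one costs `1 + 2ε`. -/
theorem measure_image_graphParam_bounds {a : Space m} {s : Set (Space m)} {ε : ℝ≥0}
    (h : ApproximatesLinearOn g (innerSL ℝ a) s ε)
    (ha : ∀ y ∈ s, ‖fderiv ℝ g y - innerSL ℝ a‖ ≤ 2 * ε) :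
    Measure.euclideanHausdorffMeasure m (graphParam R g '' s)
      ≤ (((1 + ε) ^ m * (1 + 2 * ε) : ℝ≥0) : ℝ≥0∞)
        * ∫⁻ y in s, ENNReal.ofReal (graphDensity g y) ∧
    ∫⁻ y in s, ENNReal.ofReal (graphDensity g y)
      ≤ (((1 + ε) ^ m * (1 + 2 * ε) : ℝ≥0) : ℝ≥0∞)
        * Measure.euclideanHausdorffMeasure m (graphParam R g '' s) := by
  have hJ : Measurable fun y => ENNReal.ofReal (graphDensity g y) :=
    (measurable_graphDensity g).ennreal_ofReal
  obtain ⟨h1, h2⟩ := edist_graphParam_le R h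
  have h1' := euclideanHausdorffMeasure_image_le_of_edist_le h1 m
  have h2' := euclideanHausdorffMeasure_image_le_of_edist_le h2 m
  rw [volume_image_graphStretch] at h1' h2'
  have hcoe : ((1 + 2 * ε : ℝ≥0) : ℝ≥0∞) = ENNReal.ofReal (1 + 2 * ε) := by
    rw [← ENNReal.ofReal_coe_nnreal]; push_cast; rfl
  have hd1 : ∀ y ∈ s, ENNReal.ofReal √(1 + ‖a‖ ^ 2)
      ≤ ((1 + 2 * ε : ℝ≥0) : ℝ≥0∞) * ENNReal.ofReal (graphDensity g y) := by
    intro y hy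
    rw [hcoe, ← ENNReal.ofReal_mul (by positivity)]
    refine ENNReal.ofReal_le_ofReal (sqrt_one_add_sq_le (norm_nonneg _) (by positivity) ?_)
    have h3 := norm_sub_norm_le (innerSL ℝ a) (fderiv ℝ g y)
    rw [norm_sub_rev, innerSL_apply_norm] at h3
    linarith [ha y hy]
  have hd2 : ∀ y ∈ s, ENNReal.ofReal (graphDensity g y)
      ≤ ((1 + 2 * ε : ℝ≥0) : ℝ≥0∞) * ENNReal.ofReal √(1 + ‖a‖ ^ 2) := by
    intro y hy
    rw [hcoe, ← ENNReal.ofReal_mul (by positivity)]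
    refine ENNReal.ofReal_le_ofReal (sqrt_one_add_sq_le (norm_nonneg _) (by positivity) ?_)
    have h3 := norm_sub_norm_le (fderiv ℝ g y) (innerSL ℝ a)
    rw [innerSL_apply_norm] at h3
    linarith [ha y hy]
  have hi1 : ENNReal.ofReal √(1 + ‖a‖ ^ 2) * volume s
      ≤ ((1 + 2 * ε : ℝ≥0) : ℝ≥0∞) * ∫⁻ y in s, ENNReal.ofReal (graphDensity g y) := by
    rw [← setLIntegral_const, ← lintegral_const_mul _ hJ]
    exact setLIntegral_mono (hJ.const_mul _) hd1
  have hi2 : ∫⁻ y in s, ENNReal.ofReal (graphDensity g y)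
      ≤ ((1 + 2 * ε : ℝ≥0) : ℝ≥0∞) * (ENNReal.ofReal √(1 + ‖a‖ ^ 2) * volume s) := by
    rw [← setLIntegral_const, ← lintegral_const_mul _ measurable_const]
    exact setLIntegral_mono measurable_const hd2
  constructor
  · refine h1'.trans ?_
    rw [ENNReal.coe_mul, ENNReal.coe_pow, mul_assoc]
    gcongr
  · refine hi2.trans ?_
    rw [ENNReal.coe_mul, ENNReal.coe_pow, mul_comm ((_ : ℝ≥0∞) ^ m), mul_assoc]
    gcongr

theorem measure_image_graphParam_bounds_of_differentiable (hg : Continuous g)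
    {s : Set (Space m)} (hs : MeasurableSet s) (hd : ∀ y ∈ s, DifferentiableAt ℝ g y)
    {ε : ℝ≥0} (hε : ε ≠ 0) :
    (Measure.euclideanHausdorffMeasure m).comap (graphParam R g) s
      ≤ (((1 + ε) ^ m * (1 + 2 * ε) : ℝ≥0) : ℝ≥0∞)
        * volume.withDensity (fun y => ENNReal.ofReal (graphDensity g y)) s ∧
    volume.withDensity (fun y => ENNReal.ofReal (graphDensity g y)) s
      ≤ (((1 + ε) ^ m * (1 + 2 * ε) : ℝ≥0) : ℝ≥0∞)
        * (Measure.euclideanHausdorffMeasure m).comap (graphParam R g) s := by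
  -- Approximate linearity alone does not control the derivative pointwise, so the set is first cut
  -- according to the value of `fderiv ℝ g`. Each linear map of the partition is a derivative at
  -- some point of the same `Q k`, hence within `2ε` of all the others there.
  set Q : ℕ → Set (Space m) := fun k => (fun y => fderiv ℝ g y) ⁻¹'
    Metric.ball (TopologicalSpace.denseSeq (Space m →L[ℝ] ℝ) k) ε with hQ
  have hQm : ∀ k, MeasurableSet (Q k) := fun k =>
    (measurable_fderiv ℝ g) Metric.isOpen_ball.measurableSet
  have hQc : s ⊆ ⋃ k, Q k := by
    intro y _
    obtain ⟨k, hk⟩ := (TopologicalSpace.denseRange_denseSeq (Space m →L[ℝ] ℝ)).exists_dist_lt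
      (fderiv ℝ g y) (ε := ε) (by positivity)
    exact mem_iUnion.2 ⟨k, hk⟩
  have key : ∀ k, ∃ t : ℕ → Set (Space m), (∀ n, MeasurableSet (t n)) ∧ s ∩ Q k ⊆ ⋃ n, t n ∧
      ∀ n, ∀ A ⊆ (s ∩ Q k) ∩ t n, ∃ a : Space m,
        ApproximatesLinearOn g (innerSL ℝ a) A ε ∧
        ∀ y ∈ A, ‖fderiv ℝ g y - innerSL ℝ a‖ ≤ 2 * ε := by
    intro k
    obtain ⟨t, L, -, ht, hc, ha, hL⟩ := exists_partition_approximatesLinearOn_of_hasFDerivWithinAt g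
      (s ∩ Q k) (fderiv ℝ g) (fun y hy => (hd y hy.1).hasFDerivAt.hasFDerivWithinAt) (fun _ => ε)
      (fun _ => hε)
    refine ⟨t, ht, hc, fun n A hA => ?_⟩
    refine ⟨(InnerProductSpace.toDual ℝ (Space m)).symm (L n), ?_, fun y hy => ?_⟩
    · have : innerSL ℝ ((InnerProductSpace.toDual ℝ (Space m)).symm (L n)) = L n := by
        ext; simp
      rw [this]
      exact (ha n).mono_set hA
    · have : innerSL ℝ ((InnerProductSpace.toDual ℝ (Space m)).symm (L n)) = L n := by
        ext; simp
      rw [this]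
      obtain ⟨z, hz, hzL⟩ := hL ⟨y, (hA hy).1⟩ n
      have h1 : dist (fderiv ℝ g y) (TopologicalSpace.denseSeq (Space m →L[ℝ] ℝ) k) < ε :=
        (hA hy).1.2
      have h2 : dist (fderiv ℝ g z) (TopologicalSpace.denseSeq (Space m →L[ℝ] ℝ) k) < ε := hz.2
      rw [hzL, ← dist_eq_norm]
      linarith [dist_triangle_right (fderiv ℝ g y) (fderiv ℝ g z)
        (TopologicalSpace.denseSeq (Space m →L[ℝ] ℝ) k)]
  have happ : ∀ A, (Measure.euclideanHausdorffMeasure m).comap (graphParam R g) A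
      = Measure.euclideanHausdorffMeasure m (graphParam R g '' A) :=
    fun A => (measurableEmbedding_graphParam R hg).comap_apply _ A
  constructor
  · refine measure_le_mul_of_subset_iUnion hs hQm hQc fun k A hA hAm => ?_
    obtain ⟨t, ht, hc, h⟩ := key k
    refine measure_le_mul_of_subset_iUnion hAm ht (hA.trans hc) fun n B hB hBm => ?_
    obtain ⟨a, h1, h2⟩ := h n B (hB.trans (inter_subset_inter_left _ hA))
    rw [happ, withDensity_apply _ hBm]
    exact (measure_image_graphParam_bounds R h1 h2).1
  · refine measure_le_mul_of_subset_iUnion hs hQm hQc fun k A hA hAm => ?_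
    obtain ⟨t, ht, hc, h⟩ := key k
    refine measure_le_mul_of_subset_iUnion hAm ht (hA.trans hc) fun n B hB hBm => ?_
    obtain ⟨a, h1, h2⟩ := h n B (hB.trans (inter_subset_inter_left _ hA))
    rw [happ, withDensity_apply _ hBm]
    exact (measure_image_graphParam_bounds R h1 h2).2

theorem ennreal_le_of_forall_nnreal {a b : ℝ≥0∞} (m : ℕ)
    (h : ∀ ε : ℝ≥0, ε ≠ 0 → a ≤ (((1 + ε) ^ m * (1 + 2 * ε) : ℝ≥0) : ℝ≥0∞) * b) : a ≤ b := by
  have hc : Filter.Tendsto (fun ε : ℝ≥0 => (((1 + ε) ^ m * (1 + 2 * ε) : ℝ≥0) : ℝ≥0∞) * b)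
      (nhdsWithin 0 {0}ᶜ) (nhds (((1 : ℝ≥0) : ℝ≥0∞) * b)) := by
    refine ENNReal.Tendsto.mul_const ?_ (Or.inl (by simp))
    rw [ENNReal.tendsto_coe]
    have : Continuous fun ε : ℝ≥0 => (1 + ε) ^ m * (1 + 2 * ε) := by fun_prop
    simpa using (this.tendsto 0).mono_left nhdsWithin_le_nhds
  rw [ENNReal.coe_one, one_mul] at hc
  exact ge_of_tendsto hc (eventually_mem_nhdsWithin.mono fun ε hε => h ε hε)

/-- The area formula for a Lipschitz graph. -/
theorem comap_graphParam {K : ℝ≥0} (hg : LipschitzWith K g) :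
    (Measure.euclideanHausdorffMeasure m).comap (graphParam R g)
      = volume.withDensity (fun y => ENNReal.ofReal (graphDensity g y)) := by
  have hD : MeasurableSet {y | DifferentiableAt ℝ g y} := measurableSet_of_differentiableAt ℝ g
  -- Rademacher's theorem; the Lipschitz parametrisation carries this null set to a null set, so
  -- only differentiability points count.
  have hN : volume {y | DifferentiableAt ℝ g y}ᶜ = 0 := hg.ae_differentiableAt
  have hN1 : (Measure.euclideanHausdorffMeasure m).comap (graphParam R g)
      {y | DifferentiableAt ℝ g y}ᶜ = 0 := by
    rw [(measurableEmbedding_graphParam R hg.continuous).comap_apply]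
    have := euclideanHausdorffMeasure_image_le_of_edist_le (h := (id : Space m → Space m))
      (s := {y | DifferentiableAt ℝ g y}ᶜ)
      (fun x _ y _ => lipschitz_graphParam R hg x y) m
    rw [image_id, EuclideanSpace.euclideanHausdorffMeasure_eq_volume, hN, mul_zero] at this
    exact nonpos_iff_eq_zero.1 this
  have hN2 : volume.withDensity (fun y => ENNReal.ofReal (graphDensity g y))
      {y | DifferentiableAt ℝ g y}ᶜ = 0 := withDensity_absolutelyContinuous _ _ hN
  ext s hs
  rw [← measure_inter_add_sdiff s hD, ← measure_inter_add_sdiff (μ := volume.withDensity _) s hD,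
    measure_mono_null (fun x hx => hx.2 : s \ _ ⊆ _) hN1,
    measure_mono_null (fun x hx => hx.2 : s \ _ ⊆ _) hN2, add_zero,
    add_zero]
  have hb := fun (ε : ℝ≥0) (hε : ε ≠ 0) => measure_image_graphParam_bounds_of_differentiable R
    hg.continuous (hs.inter hD) (fun y hy => hy.2) hε
  exact le_antisymm (ennreal_le_of_forall_nnreal m fun ε hε => (hb ε hε).1)
    (ennreal_le_of_forall_nnreal m fun ε hε => (hb ε hε).2)

theorem integral_range_graphParam {E : Type*} [NormedAddCommGroup E] [NormedSpace ℝ E]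
    {K : ℝ≥0} (hg : LipschitzWith K g) (h : Space d → E) :
    ∫ x in range (graphParam R g), h x ∂(Measure.euclideanHausdorffMeasure m)
      = ∫ y, graphDensity g y • h (graphParam R g y) := by
  have hΓ := measurableEmbedding_graphParam R hg.continuous
  rw [← hΓ.map_comap, hΓ.integral_map, comap_graphParam R hg,
    integral_withDensity_eq_integral_toReal_smul (measurable_graphDensity g).ennreal_ofReal
      (Filter.Eventually.of_forall fun _ => ENNReal.ofReal_lt_top)]
  simp_rw [ENNReal.toReal_ofReal (graphDensity_nonneg g _)]

end AreaFormula

/-! ### Integration by parts on a Lipschitz subgraph -/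

/-- Compactness gives a Lipschitz constant on a ball one unit larger than one containing the
support. A point of the small ball and a point outside the large one are at least `1` apart, so
there the sup bound serves as a Lipschitz constant. -/
theorem exists_lipschitzWith_of_hasCompactSupport {E F : Type*} [NormedAddCommGroup E]
    [ProperSpace E] [NormedAddCommGroup F] {h : E → F} (hl : LocallyLipschitz h)
    (hs : HasCompactSupport h) : ∃ C, LipschitzWith C h := by
  obtain ⟨ρ, hρ⟩ := hs.isBounded.subset_closedBall 0
  obtain ⟨C, hC⟩ := (hl.locallyLipschitzOn (s := Metric.closedBall (0 : E) (ρ + 1))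
    ).exists_lipschitzOnWith_of_compact (isCompact_closedBall _ _)
  obtain ⟨M, hM⟩ := hs.exists_bound_of_continuous hl.continuous
  have hM0 : 0 ≤ M := (norm_nonneg _).trans (hM 0)
  have hz : ∀ x, ρ < ‖x‖ → h x = 0 := fun x hx => image_eq_zero_of_notMem_tsupport fun hx' => by
    have := hρ hx'
    rw [mem_closedBall_zero_iff] at this
    linarith
  have haux : ∀ x y, ‖x‖ ≤ ρ → ρ + 1 < ‖y‖ → dist (h x) (h y) ≤ M * dist x y := by
    intro x y hx hy
    rw [hz y (by linarith), dist_zero_right]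
    have : 1 ≤ dist x y := by
      rw [dist_comm, dist_eq_norm]
      linarith [norm_sub_norm_le y x]
    nlinarith [hM x]
  refine ⟨C + ⟨M, hM0⟩, LipschitzWith.of_dist_le_mul fun x y => ?_⟩
  have hcm : ((C + ⟨M, hM0⟩ : ℝ≥0) : ℝ) = C + M := rfl
  rw [hcm, add_mul]
  have h1 : 0 ≤ C * dist x y := by positivity
  have h2 : 0 ≤ M * dist x y := by positivity
  by_cases hx : ‖x‖ ≤ ρ + 1 <;> by_cases hy : ‖y‖ ≤ ρ + 1
  · have := hC.dist_le_mul x (by simpa using hx) y (by simpa using hy)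
    linarith
  · by_cases hx' : ‖x‖ ≤ ρ
    · linarith [haux x y hx' (not_le.1 hy)]
    · rw [hz x (not_le.1 hx'), hz y (by linarith), dist_self]; positivity
  · by_cases hy' : ‖y‖ ≤ ρ
    · rw [dist_comm (h x), dist_comm x] at *
      linarith [haux y x hy' (not_le.1 hx)]
    · rw [hz y (not_le.1 hy'), hz x (by linarith), dist_self]; positivity
  · rw [hz x (by linarith), hz y (by linarith), dist_self]; positivity

theorem integral_lineDeriv_eq_zero {h : Space m → ℝ} {C : ℝ≥0} (hl : LipschitzWith C h)
    (hs : HasCompactSupport h) (w : Space m) : ∫ y, lineDeriv ℝ h y w = 0 := by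
  have := LipschitzWith.integral_lineDeriv_mul_eq (μ := volume)
    (LipschitzWith.const (1 : ℝ) : LipschitzWith 0 fun _ : Space m => (1 : ℝ)) hl hs (-w)
  simpa [lineDeriv] using this.symm

/-! ### Gauss–Green below a single graph -/

section Subgraph

variable (R : Space d ≃ₗᵢ[ℝ] WithLp 2 (Space m × ℝ)) {g : Space m → ℝ}

/-- The open region below a graph, in rotated coordinates. -/
def subgraph (g : Space m → ℝ) : Set (Space d) := {x | (R x).snd < g (R x).fst}

/-- Coordinates adapted to a graph: the second coordinate is the signed height above it. -/
def graphCoord (g : Space m → ℝ) (z : Space m × ℝ) : Space d :=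
  R.symm (WithLp.toLp 2 (z.1, g z.1 + z.2))

theorem graphCoord_zero (g : Space m → ℝ) (y : Space m) :
    graphCoord R g (y, 0) = graphParam R g y := by simp [graphCoord, graphParam]

theorem isOpen_subgraph (hg : Continuous g) : IsOpen (subgraph R g) := by
  unfold subgraph
  refine isOpen_lt ?_ ?_
  · fun_prop
  · fun_prop

theorem graphCoord_mem_subgraph {z : Space m × ℝ} : graphCoord R g z ∈ subgraph R g ↔ z.2 < 0 := by
  simp [graphCoord, subgraph]

theorem continuous_graphCoord (hg : Continuous g) : Continuous (graphCoord R g) := by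
  unfold graphCoord
  fun_prop

theorem injective_graphCoord : Function.Injective (graphCoord R g) := by
  rintro ⟨y, r⟩ ⟨y', r'⟩ h
  have h' := R.symm.injective h
  have h1 : y = y' := congrArg WithLp.fst h'
  have h2 : g y + r = g y' + r' := congrArg WithLp.snd h'
  subst h1
  simpa using h2

/-- A shear translates each vertical fibre, so no differentiability of `g` is needed. -/
theorem measurePreserving_graphCoord (hg : Continuous g) :
    MeasurePreserving (graphCoord R g) (volume.prod volume) volume := by
  have h1 : MeasurePreserving (fun z : Space m × ℝ => (z.1, g z.1 + z.2)) (volume.prod volume)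
      (volume.prod volume) := by
    refine (MeasurePreserving.id (volume : Measure (Space m))).skew_product
      (g := fun y r => g y + r) ?_ ?_
    · fun_prop
    · exact Eventually.of_forall fun y => map_add_left_eq_self volume (g y)
  exact R.symm.measurePreserving.comp ((WithLp.volume_preserving_toLp _ _).comp h1)

theorem norm_graphCoord_sq (z : Space m × ℝ) :
    ‖graphCoord R g z‖ ^ 2 = ‖z.1‖ ^ 2 + (g z.1 + z.2) ^ 2 := by
  rw [graphCoord, LinearIsometryEquiv.norm_map, WithLp.prod_norm_sq_eq_of_L2]
  simp

theorem norm_fst_le_graphCoord (z : Space m × ℝ) : ‖z.1‖ ≤ ‖graphCoord R g z‖ := by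
  refine abs_le_of_sq_le_sq' ?_ (norm_nonneg _) |>.2
  rw [norm_graphCoord_sq]
  nlinarith [sq_nonneg (g z.1 + z.2)]

theorem abs_height_le_graphCoord (z : Space m × ℝ) : |g z.1 + z.2| ≤ ‖graphCoord R g z‖ := by
  refine abs_le_of_sq_le_sq ?_ (norm_nonneg _)
  rw [norm_graphCoord_sq]
  nlinarith [sq_nonneg ‖z.1‖]

/-- The unit vector along which the graph coordinates measure height. -/
def upVec : Space d := R.symm (WithLp.toLp 2 (0, 1))

theorem hasDerivAt_graphCoord (y : Space m) (r : ℝ) :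
    HasDerivAt (fun s => graphCoord R g (y, s)) (upVec R) r := by
  have : (fun s => graphCoord R g (y, s)) = fun s => graphCoord R g (y, 0) + s • upVec R := by
    ext1 s
    rw [graphCoord, graphCoord, upVec, ← map_smul, ← map_add, ← WithLp.toLp_smul, ← WithLp.toLp_add]
    simp
  rw [this]
  simpa using ((hasDerivAt_id r).smul_const (upVec R)).const_add (graphCoord R g (y, 0))

theorem hasDerivAt_graphCoord_line {y : Space m} (hy : DifferentiableAt ℝ g y) (r : ℝ) (w : Space m) :
    HasDerivAt (fun t : ℝ => graphCoord R g (y + t • w, r))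
      (R.symm (WithLp.toLp 2 (w, fderiv ℝ g y w))) 0 := by
  have h1 : HasDerivAt (fun t : ℝ => g (y + t • w) + r) (fderiv ℝ g y w) 0 := by
    have : HasLineDerivAt ℝ g (fderiv ℝ g y w) y w := hy.hasFDerivAt.hasLineDerivAt w
    exact HasDerivAt.add_const r this
  have h2 : HasDerivAt (fun t : ℝ => y + t • w) w 0 := by
    simpa using ((hasDerivAt_id (0 : ℝ)).smul_const w).const_add y
  have h3 := (((WithLp.prodContinuousLinearEquiv 2 ℝ (Space m) ℝ).symm.toContinuousLinearMap
    ).hasFDerivAt (x := (y + (0 : ℝ) • w, g (y + (0 : ℝ) • w) + r))).comp_hasDerivAt (0 : ℝ) (h2.prodMk h1)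
  exact (R.symm.toContinuousLinearEquiv.toContinuousLinearMap.hasFDerivAt).comp_hasDerivAt (0 : ℝ) h3

variable {K : ℝ≥0} {F : Space d → ℝ} {C : ℝ}

/-- Used with `c = fderiv ℝ g y (R w).fst`: removing the right multiple of `upVec R` from `w` leaves
a vector tangent to the translated graph. -/
theorem fderiv_eq_of_graphCoord (x w : Space d) (c : ℝ) :
    fderiv ℝ F x w - ((R w).snd - c) * fderiv ℝ F x (upVec R)
      = fderiv ℝ F x (R.symm (WithLp.toLp 2 ((R w).fst, c))) := by
  rw [← smul_eq_mul, ← map_smul, ← map_sub]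
  congr 1
  apply R.injective
  rw [map_sub, map_smul, upVec, R.apply_symm_apply, R.apply_symm_apply, ← WithLp.toLp_smul]
  apply WithLp.ofLp_injective
  ext <;> simp

theorem integrableOn_subgraph_fderiv (hg : Continuous g) (hF : HasCompactSupport F)
    (hb : ∀ x ∈ subgraph R g, ‖fderiv ℝ F x‖ ≤ C) (w : Space d) :
    IntegrableOn (fun x => fderiv ℝ F x w) (subgraph R g) := by
  have h1 : Integrable ((tsupport F).indicator fun _ : Space d => C * ‖w‖) :=
    (integrable_indicator_iff (isClosed_tsupport F).measurableSet).2
      (integrableOn_const hF.measure_lt_top.ne)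
  refine h1.integrableOn.mono' (measurable_fderiv_apply_const ℝ F w).aestronglyMeasurable ?_
  filter_upwards [ae_restrict_mem (isOpen_subgraph R hg).measurableSet] with x hx
  by_cases hxs : x ∈ tsupport F
  · rw [indicator_of_mem hxs]
    exact ((fderiv ℝ F x).le_opNorm w).trans (by gcongr; exact hb x hx)
  · rw [indicator_of_notMem hxs]
    have : fderiv ℝ F x = 0 := by
      by_contra h
      exact hxs (support_fderiv_subset ℝ h)
    simp [this]

/-- In graph coordinates `∂_w` is a tangential derivative plus `(w_s - ∇g · w')` times the vertical
one, with `w = (w', w_s)`. On each slice of constant height the tangential part has zero integral.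
The factor depends on `y` only, so it leaves the vertical integral, which yields the boundary value
of `F`. Continuity up to the graph is needed only along vertical lines. -/
theorem integral_subgraph_fderiv (hg : LipschitzWith K g) (hF : HasCompactSupport F)
    (hd : ContDiffOn ℝ 1 F (subgraph R g))
    (hb : ∀ x ∈ subgraph R g, ‖fderiv ℝ F x‖ ≤ C)
    (hc : ∀ y, ContinuousWithinAt (fun r => F (graphCoord R g (y, r))) (Iic 0) 0) (w : Space d) :
    ∫ x in subgraph R g, fderiv ℝ F x w
      = ∫ y, F (graphParam R g y) * ((R w).snd - fderiv ℝ g y (R w).fst) := by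
  have hopen := isOpen_subgraph R hg.continuous
  have hΨ := measurePreserving_graphCoord R hg.continuous
  have hΨe : MeasurableEmbedding (graphCoord R g) :=
    (continuous_graphCoord R hg.continuous).measurableEmbedding (injective_graphCoord R)
  have hpre : graphCoord R g ⁻¹' (subgraph R g) = univ ×ˢ Iio 0 := by
    ext z; simp [graphCoord_mem_subgraph]
  set ν : Measure (Space m × ℝ) := volume.prod (volume.restrict (Iio 0)) with hν
  have hrestr : (volume.prod volume).restrict (graphCoord R g ⁻¹' (subgraph R g)) = ν := by
    rw [hpre, ← Measure.prod_restrict, Measure.restrict_univ]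
  have hint : ∀ w, Integrable (fun z => fderiv ℝ F (graphCoord R g z) w) ν := by
    intro w
    rw [← hrestr]
    exact (hΨ.integrableOn_comp_preimage hΨe).2
      (integrableOn_subgraph_fderiv R hg.continuous hF hb w)
  have hA : ∫ x in subgraph R g, fderiv ℝ F x w
      = ∫ z, fderiv ℝ F (graphCoord R g z) w ∂ν := by
    rw [← hrestr]
    exact (hΨ.setIntegral_preimage_emb hΨe _ _).symm
  obtain ⟨ρ, hρ⟩ := hF.isBounded.subset_closedBall 0
  have hz : ∀ x, ρ < ‖x‖ → F x = 0 := fun x hx => image_eq_zero_of_notMem_tsupport fun hx' => by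
    have := hρ hx'
    rw [mem_closedBall_zero_iff] at this
    linarith
  have hdiff : ∀ z : Space m × ℝ, z.2 < 0 → ContDiffAt ℝ 1 F (graphCoord R g z) := fun z hz =>
    hd.contDiffAt (hopen.mem_nhds ((graphCoord_mem_subgraph R).2 hz))
  have hslice : ∀ r < 0, ∫ y, (fderiv ℝ F (graphCoord R g (y, r)) w
      - ((R w).snd - fderiv ℝ g y (R w).fst) * fderiv ℝ F (graphCoord R g (y, r)) (upVec R)) = 0 := by
    intro r hr
    have hlip : LipschitzWith (1 + K) fun y => graphCoord R g (y, r) := by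
      refine lipschitz_graphParam R (g := fun y => g y + r) ?_
      simpa using hg.add (LipschitzWith.const r)
    have hloc : LocallyLipschitz fun y => F (graphCoord R g (y, r)) := by
      intro y
      obtain ⟨C', t, ht, hC'⟩ := (hdiff (y, r) hr).exists_lipschitzOnWith
      exact ⟨C' * (1 + K), _, hlip.continuous.continuousAt.preimage_mem_nhds ht,
        hC'.comp hlip.lipschitzOnWith (mapsTo_preimage _ _)⟩
    have hcs : HasCompactSupport fun y => F (graphCoord R g (y, r)) := by
      refine HasCompactSupport.intro (isCompact_closedBall (0 : Space m) ρ) fun y hy => hz _ ?_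
      rw [mem_closedBall_zero_iff, not_le] at hy
      exact hy.trans_le (norm_fst_le_graphCoord R (y, r))
    obtain ⟨C', hC'⟩ := exists_lipschitzWith_of_hasCompactSupport hloc hcs
    rw [← integral_lineDeriv_eq_zero hC' hcs (R w).fst]
    refine integral_congr_ae ?_
    filter_upwards [hg.ae_differentiableAt] with y hy
    rw [fderiv_eq_of_graphCoord]
    refine (HasLineDerivAt.lineDeriv ?_).symm
    have h2 := hasDerivAt_graphCoord_line R hy r (R w).fst
    have h1 : HasFDerivAt F (fderiv ℝ F (graphCoord R g (y, r)))
        (graphCoord R g (y + (0 : ℝ) • (R w).fst, r)) := by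
      rw [zero_smul, add_zero]
      exact ((hdiff (y, r) hr).differentiableAt (by norm_num)).hasFDerivAt
    exact h1.comp_hasDerivAt (0 : ℝ) h2
  have hcm : Measurable fun z : Space m × ℝ => (R w).snd - fderiv ℝ g z.1 (R w).fst :=
    ((measurable_fderiv_apply_const ℝ g _).comp measurable_fst).const_sub _
  have hB : Integrable (fun z : Space m × ℝ => ((R w).snd - fderiv ℝ g z.1 (R w).fst)
      * fderiv ℝ F (graphCoord R g z) (upVec R)) ν := by
    refine (hint (upVec R)).bdd_mul (c := |(R w).snd| + K * ‖(R w).fst‖)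
      hcm.aestronglyMeasurable (Eventually.of_forall fun z => ?_)
    refine (norm_sub_le _ _).trans ?_
    gcongr
    · exact le_rfl
    · exact ((fderiv ℝ g z.1).le_opNorm _).trans (by gcongr; exact norm_fderiv_le_of_lipschitz ℝ hg)
  have hAB : ∫ z, fderiv ℝ F (graphCoord R g z) w ∂ν = ∫ z : Space m × ℝ,
      ((R w).snd - fderiv ℝ g z.1 (R w).fst) * fderiv ℝ F (graphCoord R g z) (upVec R) ∂ν := by
    rw [← sub_eq_zero, ← integral_sub (hint w) hB, hν]
    refine (integral_prod_symm _ ((hint w).sub hB)).trans ?_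
    refine (setIntegral_congr_fun measurableSet_Iio fun r hr => hslice r hr).trans ?_
    simp
  rw [hA, hAB, hν, integral_prod _ hB]
  refine integral_congr_ae ?_
  filter_upwards [(hint (upVec R)).prod_right_ae] with y hy
  rw [integral_const_mul, mul_comm]
  congr 1
  rw [← integral_Iic_eq_integral_Iio, integral_Iic_of_hasDerivAt_of_tendsto (hc y) (m := 0) ?_ ?_ ?_,
    sub_zero, graphCoord_zero]
  · intro r hr
    exact ((hdiff (y, r) hr).differentiableAt (by norm_num)).hasFDerivAt.comp_hasDerivAt r
      (hasDerivAt_graphCoord R y r)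
  · exact (integrableOn_Iic_iff_integrableOn_Iio).2 hy
  · refine tendsto_const_nhds.congr' ?_
    -- Below this height `|g y + r| > ρ`, so the point has left the ball containing the support.
    filter_upwards [eventually_lt_atBot (-ρ - g y)] with r hr
    refine (hz _ ?_).symm
    refine lt_of_lt_of_le ?_ (abs_height_le_graphCoord R (y, r))
    rw [lt_abs]
    right
    simp only
    linarith

end Subgraph

/-! ### Geometry of Lipschitz domains -/

section Graph

variable (R : Space d ≃ₗᵢ[ℝ] WithLp 2 (Space m × ℝ)) {g : Space m → ℝ}

theorem frontier_subgraph (hg : Continuous g) : frontier (subgraph R g) = range (graphParam R g) := by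
  apply Subset.antisymm
  · intro x hx
    have h : (R x).snd = g (R x).fst :=
      frontier_lt_subset_eq (f := fun x => (R x).snd) (g := fun x => g (R x).fst)
        (by fun_prop) (by fun_prop) hx
    refine ⟨(R x).fst, ?_⟩
    rw [graphParam, ← h]
    exact R.symm_apply_apply x
  · rintro _ ⟨y, rfl⟩
    rw [(isOpen_subgraph R hg).frontier_eq, ← graphCoord_zero]
    refine ⟨?_, fun h => lt_irrefl _ ((graphCoord_mem_subgraph R).1 h)⟩
    have hc : Tendsto (fun r => graphCoord R g (y, r)) (𝓝[<] 0) (𝓝 (graphCoord R g (y, 0))) :=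
      ((continuous_graphCoord R hg).comp (Continuous.prodMk_right y)).continuousAt.tendsto.mono_left
        nhdsWithin_le_nhds
    exact mem_closure_of_tendsto hc
      (eventually_mem_nhdsWithin.mono fun r hr => (graphCoord_mem_subgraph R).2 hr)

/-- The upward unit normal of a graph over the base point `y`. -/
def graphNormal (g : Space m → ℝ) (y : Space m) : Space d :=
  (graphDensity g y)⁻¹ •
    R.symm (WithLp.toLp 2 (-(InnerProductSpace.toDual ℝ (Space m)).symm (fderiv ℝ g y), 1))

theorem measurable_graphNormal (g : Space m → ℝ) : Measurable (graphNormal R g) := by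
  unfold graphNormal
  refine (measurable_graphDensity g).inv.smul ?_
  have h : Continuous fun L : Space m →L[ℝ] ℝ => R.symm
      (WithLp.toLp 2 (-(InnerProductSpace.toDual ℝ (Space m)).symm L, (1 : ℝ))) := by fun_prop
  exact h.measurable.comp (measurable_fderiv ℝ g)

theorem inner_graphNormal (g : Space m → ℝ) (y : Space m) (w : Space d) :
    inner ℝ w (graphNormal R g y)
      = (graphDensity g y)⁻¹ * ((R w).snd - fderiv ℝ g y (R w).fst) := by
  rw [graphNormal, inner_smul_right, ← R.inner_map_map w, R.apply_symm_apply,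
    WithLp.prod_inner_apply]
  simp only [inner_neg_right]
  rw [real_inner_comm, InnerProductSpace.toDual_symm_apply]
  simp
  left
  ring

theorem norm_graphNormal (g : Space m → ℝ) (y : Space m) : ‖graphNormal R g y‖ = 1 := by
  have h1 := one_le_graphDensity g y
  rw [graphNormal, norm_smul, R.symm.norm_map, norm_inv, Real.norm_of_nonneg (by linarith)]
  have h2 : ‖WithLp.toLp 2 (-(InnerProductSpace.toDual ℝ (Space m)).symm (fderiv ℝ g y), (1 : ℝ))‖
      = graphDensity g y := by
    rw [WithLp.prod_norm_eq_of_L2, graphDensity]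
    simp [add_comm]
  rw [h2, inv_mul_cancel₀ (by linarith)]

/-- The normal component of `z - x` is the linearised height over the graph divided by `graphDensity
g y`. That density is at least `1`, so a normal component beyond `ε‖z - x‖` beats the Taylor error
of `g` and decides the side of the graph. -/
theorem isOuterNormal_graphNormal {Ω U : Set (Space d)} (hU : IsOpen U)
    (hΩ : Ω ∩ U = {x | x ∈ U ∧ (R x).snd < g (R x).fst}) {y : Space m}
    (hy : DifferentiableAt ℝ g y) (hyU : graphParam R g y ∈ U) :
    IsOuterNormal Ω (graphParam R g y) (graphNormal R g y) := by
  refine ⟨norm_graphNormal R g y, fun ε hε => ?_⟩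
  have h1 : ∀ᶠ y' in 𝓝 y, |g y' - g y - fderiv ℝ g y (y' - y)| ≤ ε * ‖y' - y‖ := by
    have := hy.hasFDerivAt.isLittleO.def hε
    simpa using this
  have hR : R (graphParam R g y) = WithLp.toLp 2 (y, g y) := R.apply_symm_apply _
  have h2 : ∀ᶠ z in 𝓝 (graphParam R g y),
      |g (R z).fst - g y - fderiv ℝ g y ((R z).fst - y)| ≤ ε * ‖(R z).fst - y‖ := by
    have hc : Tendsto (fun z => (R z).fst) (𝓝 (graphParam R g y)) (𝓝 y) := by
      have : Continuous fun z => (R z).fst := by fun_prop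
      simpa [hR] using this.tendsto (graphParam R g y)
    exact hc.eventually h1
  obtain ⟨δ, hδ, H⟩ := Metric.eventually_nhds_iff.1 (h2.and (hU.mem_nhds hyU))
  refine ⟨δ, hδ, fun z hz => ?_⟩
  obtain ⟨h3, hzU⟩ := H (by rwa [dist_eq_norm])
  have hmem : z ∈ Ω ↔ (R z).snd < g (R z).fst := by
    constructor
    · intro h
      have : z ∈ Ω ∩ U := ⟨h, hzU⟩
      rw [hΩ] at this
      exact this.2
    · intro h
      have : z ∈ Ω ∩ U := by rw [hΩ]; exact ⟨hzU, h⟩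
      exact this.1
  have hnorm : ‖(R z).fst - y‖ ≤ ‖z - graphParam R g y‖ := by
    rw [← R.norm_map (z - _), map_sub, hR]
    refine abs_le_of_sq_le_sq' ?_ (norm_nonneg _) |>.2
    rw [WithLp.prod_norm_sq_eq_of_L2]
    change _ ≤ ‖(R z).fst - y‖ ^ 2 + ‖(R z).snd - g y‖ ^ 2
    nlinarith [sq_nonneg ‖(R z).snd - g y‖]
  have hJ := one_le_graphDensity g y
  have hJ0 : 0 < graphDensity g y := by linarith
  have h4 : |g (R z).fst - g y - fderiv ℝ g y ((R z).fst - y)|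
      ≤ ε * ‖z - graphParam R g y‖ := h3.trans (by gcongr)
  obtain ⟨h5, h6⟩ := abs_le.1 h4
  have hin : inner ℝ (z - graphParam R g y) (graphNormal R g y)
      = (graphDensity g y)⁻¹ * ((R z).snd - g y - fderiv ℝ g y ((R z).fst - y)) := by
    rw [inner_graphNormal, map_sub, hR]
    simp
  have h7 : ε * ‖z - graphParam R g y‖ ≤ graphDensity g y * (ε * ‖z - graphParam R g y‖) :=
    le_mul_of_one_le_left (by positivity) hJ
  rw [hmem, hin, not_lt, inv_mul_lt_iff₀ hJ0, lt_inv_mul_iff₀ hJ0]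
  constructor
  · intro h
    linarith
  · intro h
    linarith

end Graph

theorem IsOuterNormal.outerNormal_eq {Ω : Set (Space d)} {x ν : Space d}
    (h : IsOuterNormal Ω x ν) : outerNormal Ω x = ν := by
  have hex : ∃ ν, IsOuterNormal Ω x ν := ⟨ν, h⟩
  rw [outerNormal, dif_pos hex]
  exact hex.choose_spec.unique h

theorem norm_outerNormal_le (Ω : Set (Space d)) (x : Space d) : ‖outerNormal Ω x‖ ≤ 1 := by
  unfold outerNormal
  split_ifs with h
  · exact h.choose_spec.1.le
  · simp

/-- Near `U`, the set `Ω` is the region below the graph of the Lipschitz function `g`. -/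
structure IsLipschitzChart (Ω U : Set (Space d))
    (R : Space d ≃ₗᵢ[ℝ] WithLp 2 (Space m × ℝ)) (g : Space m → ℝ) (K : ℝ≥0) : Prop where
  isOpen : IsOpen U
  lipschitz : LipschitzWith K g
  eq : Ω ∩ U = {x | x ∈ U ∧ (R x).snd < g (R x).fst}

/-! ### Consequences of one boundary chart -/

namespace IsLipschitzChart

variable {Ω U : Set (Space d)} {R : Space d ≃ₗᵢ[ℝ] WithLp 2 (Space m × ℝ)} {g : Space m → ℝ}
  {K : ℝ≥0} (h : IsLipschitzChart Ω U R g K)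

include h

theorem mem_iff {x : Space d} (hx : x ∈ U) : x ∈ Ω ↔ x ∈ subgraph R g := by
  have := Set.ext_iff.1 h.eq x
  simpa [hx, subgraph] using this

theorem frontier_inter : frontier Ω ∩ U = range (graphParam R g) ∩ U := by
  have h1 : Ω ∩ U = subgraph R g ∩ U := by
    ext x
    exact and_congr_left fun hx => h.mem_iff hx
  rw [← frontier_inter_open_inter h.isOpen, h1, frontier_inter_open_inter h.isOpen,
    frontier_subgraph R h.lipschitz.continuous]

theorem outerNormal_eq {y : Space m} (hy : DifferentiableAt ℝ g y) (hyU : graphParam R g y ∈ U) :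
    outerNormal Ω (graphParam R g y) = graphNormal R g y :=
  (isOuterNormal_graphNormal R h.isOpen h.eq hy hyU).outerNormal_eq

omit h in
theorem measure_image_le (hg : LipschitzWith K g) (s : Set (Space m)) :
    Measure.euclideanHausdorffMeasure m (graphParam R g '' s)
      ≤ ((1 + K : ℝ≥0) : ℝ≥0∞) ^ m * volume s := by
  have := euclideanHausdorffMeasure_image_le_of_edist_le (h := (id : Space m → Space m)) (s := s)
      (fun x _ y _ => lipschitz_graphParam R hg x y) m
  rwa [image_id, EuclideanSpace.euclideanHausdorffMeasure_eq_volume] at this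

theorem finiteAtFilter {x : Space d} (hx : x ∈ U) :
    (Measure.euclideanHausdorffMeasure m).FiniteAtFilter (𝓝[frontier Ω] x) := by
  refine ⟨frontier Ω ∩ U ∩ Metric.ball x 1, ?_, ?_⟩
  · refine inter_mem (inter_mem self_mem_nhdsWithin ?_) ?_
    · exact mem_nhdsWithin_of_mem_nhds (h.isOpen.mem_nhds hx)
    · exact mem_nhdsWithin_of_mem_nhds (Metric.ball_mem_nhds x one_pos)
  · rw [h.frontier_inter]
    have hsub : range (graphParam R g) ∩ U ∩ Metric.ball x 1
        ⊆ graphParam R g '' (graphParam R g ⁻¹' Metric.ball x 1) := by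
      rintro _ ⟨⟨⟨y, rfl⟩, -⟩, hy⟩
      exact ⟨y, hy, rfl⟩
    have hb : Bornology.IsBounded (graphParam R g ⁻¹' Metric.ball x 1) :=
      (antilipschitz_graphParam R g).isBounded_preimage Metric.isBounded_ball
    refine ((measure_mono hsub).trans (measure_image_le h.lipschitz _)).trans_lt ?_
    exact ENNReal.mul_lt_top (by simp) hb.measure_lt_top

/-- `outerNormal` is defined by choice, so measurability comes from its agreement with the explicit
graph normal off the image of the nondifferentiability set of `g`, which is null. -/
theorem aestronglyMeasurable_outerNormal :
    AEStronglyMeasurable (outerNormal Ω)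
      ((Measure.euclideanHausdorffMeasure m).restrict (frontier Ω ∩ U)) := by
  have hm : Measurable fun x => graphNormal R g (R x).fst := by
    have : Continuous fun x => (R x).fst := by fun_prop
    exact (measurable_graphNormal R g).comp this.measurable
  refine hm.aestronglyMeasurable.congr ?_
  have hnull : Measure.euclideanHausdorffMeasure m
      (graphParam R g '' {y | ¬ DifferentiableAt ℝ g y}) = 0 := by
    have h0 : volume {y | ¬ DifferentiableAt ℝ g y} = 0 := h.lipschitz.ae_differentiableAt
    have := measure_image_le (R := R) h.lipschitz {y | ¬ DifferentiableAt ℝ g y}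
    rw [h0, mul_zero] at this
    exact nonpos_iff_eq_zero.1 this
  rw [EventuallyEq, ae_restrict_iff' ((isClosed_frontier.measurableSet).inter h.isOpen.measurableSet)]
  have : ∀ᵐ x ∂(Measure.euclideanHausdorffMeasure m : Measure (Space d)),
      x ∉ graphParam R g '' {y | ¬ DifferentiableAt ℝ g y} := measure_eq_zero_iff_ae_notMem.1 hnull
  filter_upwards [this] with x hx hxU
  rw [h.frontier_inter] at hxU
  obtain ⟨⟨y, rfl⟩, hyU⟩ := hxU
  have hy : DifferentiableAt ℝ g y := by
    by_contra hy
    exact hx ⟨y, hy, rfl⟩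
  rw [h.outerNormal_eq hy hyU, graphParam, R.apply_symm_apply]
  rfl

theorem integral_frontier_eq {E : Type*} [NormedAddCommGroup E] [NormedSpace ℝ E]
    {f : Space d → E} (hf : ∀ x ∉ U, f x = 0) :
    ∫ x in frontier Ω, f x ∂(Measure.euclideanHausdorffMeasure m)
      = ∫ y, graphDensity g y • f (graphParam R g y) := by
  rw [← integral_range_graphParam R h.lipschitz]
  have h1 : ∀ s : Set (Space d), MeasurableSet s →
      ∫ x in s, f x ∂(Measure.euclideanHausdorffMeasure m)
        = ∫ x in s ∩ U, f x ∂(Measure.euclideanHausdorffMeasure m) := fun s hs =>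
    setIntegral_eq_of_subset_of_forall_sdiff_eq_zero hs inter_subset_left
      fun x hx => hf x fun hxU => hx.2 ⟨hx.1, hxU⟩
  rw [h1 _ isClosed_frontier.measurableSet, h.frontier_inter, ← h1]
  exact (measurableEmbedding_graphParam R h.lipschitz.continuous).measurableSet_range

/-- Interior cone condition: `Ω` contains a truncated open cone with apex `x` whose opening is set
by the Lipschitz constant, and a convex set with nonempty interior has unique derivatives at points
of its closure. -/
theorem uniqueDiffWithinAt {x : Space d} (hx : x ∈ frontier Ω) (hxU : x ∈ U) :
    UniqueDiffWithinAt ℝ Ω x := by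
  obtain ⟨⟨y, rfl⟩, -⟩ : x ∈ range (graphParam R g) ∩ U := by
    rw [← h.frontier_inter]; exact ⟨hx, hxU⟩
  obtain ⟨δ, hδ, hball⟩ := Metric.isOpen_iff.1 h.isOpen _ hxU
  set S : Set (Space d) := {z | K * ‖(R z).fst - y‖ + ((R z).snd - g y) < 0} with hS
  have hSopen : IsOpen S := by
    refine isOpen_lt ?_ continuous_const
    fun_prop
  have hSconv : Convex ℝ S := by
    intro a ha b hb s t hs ht hst
    have hst' : s = 1 - t := by linarith
    simp only [hS, mem_ofPred_eq, map_add, map_smul, WithLp.add_fst, WithLp.add_snd,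
      WithLp.smul_fst, WithLp.smul_snd, smul_eq_mul] at ha hb ⊢
    have h1 : s • (R a).fst + t • (R b).fst - y = s • ((R a).fst - y) + t • ((R b).fst - y) := by
      rw [hst']; module
    have h2 : ‖s • (R a).fst + t • (R b).fst - y‖ ≤ s * ‖(R a).fst - y‖ + t * ‖(R b).fst - y‖ := by
      rw [h1]
      refine (norm_add_le _ _).trans_eq ?_
      rw [norm_smul, norm_smul, Real.norm_of_nonneg hs, Real.norm_of_nonneg ht]
    have h3 := mul_le_mul_of_nonneg_left h2 K.2
    have h4 : s * (K * ‖(R a).fst - y‖ + ((R a).snd - g y))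
        + t * (K * ‖(R b).fst - y‖ + ((R b).snd - g y)) < 0 := by
      rcases hs.eq_or_lt with h0 | h0
      · have : t = 1 := by linarith
        subst this; rw [← h0]; linarith
      · have := mul_neg_of_pos_of_neg h0 ha
        have := mul_nonpos_of_nonneg_of_nonpos ht hb.le
        linarith
    change (K : ℝ) * _ ≤ (K : ℝ) * _ at h3
    have h5 : s * (g y) + t * (g y) = g y := by rw [← add_mul, hst, one_mul]
    nlinarith
  have hSsub : S ∩ Metric.ball (graphParam R g y) δ ⊆ Ω := by
    rintro z ⟨hz, hzb⟩
    refine (h.mem_iff (hball hzb)).2 ?_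
    have h1 := (abs_le.1 (h.lipschitz.norm_sub_le (R z).fst y)).1
    simp only [hS, mem_ofPred_eq] at hz
    change (R z).snd < g (R z).fst
    linarith
  refine UniqueDiffWithinAt.mono ?_ hSsub
  have hcl : graphParam R g y ∈ closure (S ∩ Metric.ball (graphParam R g y) δ) := by
    have hc : Tendsto (fun r => graphCoord R g (y, r)) (𝓝[<] 0) (𝓝 (graphParam R g y)) := by
      rw [← graphCoord_zero]
      exact ((continuous_graphCoord R h.lipschitz.continuous).comp
        (Continuous.prodMk_right y)).continuousAt.tendsto.mono_left nhdsWithin_le_nhds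
    refine mem_closure_of_tendsto hc ?_
    filter_upwards [hc (Metric.ball_mem_nhds _ hδ), eventually_mem_nhdsWithin] with r hr hr0
    refine ⟨?_, hr⟩
    have : r < 0 := hr0
    simpa [hS, graphCoord] using this
  have hop : IsOpen (S ∩ Metric.ball (graphParam R g y) δ) := hSopen.inter Metric.isOpen_ball
  refine uniqueDiffWithinAt_convex (hSconv.inter (convex_ball _ _)) ?_ hcl
  rw [hop.interior_eq]
  exact closure_nonempty_iff.1 ⟨_, hcl⟩

end IsLipschitzChart

/-! ### From charts to the whole boundary, by compactness -/

namespace IsBoundedLipschitzDomain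

variable {Ω : Set (Space d)} (hΩ : IsBoundedLipschitzDomain Ω)

include hΩ

theorem exists_chart {x : Space d} (hx : x ∈ frontier Ω) :
    ∃ (U : Set (Space d)) (R : Space d ≃ₗᵢ[ℝ] WithLp 2 (Space (d - 1) × ℝ))
      (g : Space (d - 1) → ℝ) (K : ℝ≥0), x ∈ U ∧ IsLipschitzChart Ω U R g K := by
  obtain ⟨U, hU, hxU, R, g, K, hg, h⟩ := hΩ.lipschitz x hx
  exact ⟨U, R, g, K, hxU, hU, hg, h⟩

theorem isCompact_closure : IsCompact (closure Ω) := hΩ.isBounded.isCompact_closure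

theorem isCompact_frontier : IsCompact (frontier Ω) :=
  hΩ.isCompact_closure.of_isClosed_subset isClosed_frontier frontier_subset_closure

theorem uniqueDiffOn : UniqueDiffOn ℝ (closure Ω) := by
  intro x hx
  refine UniqueDiffWithinAt.mono ?_ subset_closure
  by_cases hxΩ : x ∈ Ω
  · exact hΩ.isOpen.uniqueDiffWithinAt hxΩ
  · have hxf : x ∈ frontier Ω := by
      rw [hΩ.isOpen.frontier_eq]
      exact ⟨hx, hxΩ⟩
    obtain ⟨U, R, g, K, hxU, h⟩ := hΩ.exists_chart hxf
    exact h.uniqueDiffWithinAt hxf hxU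

theorem isFiniteMeasure_surfaceMeasure : IsFiniteMeasure (surfaceMeasure Ω) := by
  refine ⟨?_⟩
  rw [surfaceMeasure, Measure.restrict_apply_univ]
  refine hΩ.isCompact_frontier.measure_lt_top_of_nhdsWithin fun x hx => ?_
  obtain ⟨U, R, g, K, hxU, h⟩ := hΩ.exists_chart hx
  exact h.finiteAtFilter hxU

theorem aestronglyMeasurable_outerNormal :
    AEStronglyMeasurable (outerNormal Ω) (surfaceMeasure Ω) := by
  refine hΩ.isCompact_frontier.induction_on
    (p := fun s => AEStronglyMeasurable (outerNormal Ω)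
      ((Measure.euclideanHausdorffMeasure (d - 1)).restrict s)) ?_ ?_ ?_ ?_
  · simp
  · exact fun s t hst ht => ht.mono_set hst
  · exact fun s t hs ht => aestronglyMeasurable_union_iff.2 ⟨hs, ht⟩
  · intro x hx
    obtain ⟨U, R, g, K, hxU, h⟩ := hΩ.exists_chart hx
    exact ⟨_, inter_mem self_mem_nhdsWithin (mem_nhdsWithin_of_mem_nhds (h.isOpen.mem_nhds hxU)),
      h.aestronglyMeasurable_outerNormal⟩

end IsBoundedLipschitzDomain

/-! ### The divergence theorem -/

namespace IsBoundedLipschitzDomain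

variable {Ω : Set (Space d)} (hΩ : IsBoundedLipschitzDomain Ω)
  {E : Type*} [NormedAddCommGroup E] [NormedSpace ℝ E]

include hΩ

theorem fderivWithin_eq {f : Space d → E} {x : Space d} (hx : x ∈ Ω) :
    fderivWithin ℝ f (closure Ω) x = fderiv ℝ f x :=
  fderivWithin_of_mem_nhds (mem_of_superset (hΩ.isOpen.mem_nhds hx) subset_closure)

theorem contDiffAt {f : Space d → E} {n : WithTop ℕ∞} (hf : ContDiffOn ℝ n f (closure Ω))
    {x : Space d} (hx : x ∈ Ω) : ContDiffAt ℝ n f x :=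
  hf.contDiffAt (mem_of_superset (hΩ.isOpen.mem_nhds hx) subset_closure)

omit [NormedSpace ℝ E] in
theorem integrableOn {f : Space d → E} (hf : ContinuousOn f (closure Ω)) : IntegrableOn f Ω :=
  (hf.integrableOn_compact hΩ.isCompact_closure).mono_set subset_closure

theorem continuousOn_fderivWithin {f : Space d → E} (hf : ContDiffOn ℝ 1 f (closure Ω))
    (w : Space d) : ContinuousOn (fun x => fderivWithin ℝ f (closure Ω) x w) (closure Ω) :=
  (hf.continuousOn_fderivWithin hΩ.uniqueDiffOn (by norm_num)).clm_apply continuousOn_const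

omit [NormedSpace ℝ E] in
theorem integrable_surface {f : Space d → E} (hf : ContinuousOn f (closure Ω)) :
    Integrable f (surfaceMeasure Ω) := by
  have := hΩ.isFiniteMeasure_surfaceMeasure
  have hfr := hf.mono frontier_subset_closure
  obtain ⟨C, hC⟩ := hΩ.isCompact_frontier.exists_bound_of_continuousOn hfr
  refine (integrable_const C).mono' (hfr.aestronglyMeasurable isClosed_frontier.measurableSet) ?_
  filter_upwards [ae_restrict_mem isClosed_frontier.measurableSet] with x hx using hC x hx

theorem integrable_inner_outerNormal (w : Space d) {f : Space d → ℝ}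
    (hf : ContinuousOn f (closure Ω)) :
    Integrable (fun x => f x * inner ℝ w (outerNormal Ω x)) (surfaceMeasure Ω) := by
  refine (hΩ.integrable_surface hf).mul_bdd (c := ‖w‖)
    (hΩ.aestronglyMeasurable_outerNormal.const_inner) (Eventually.of_forall fun x => ?_)
  refine (norm_inner_le_norm _ _).trans ?_
  exact mul_le_of_le_one_right (norm_nonneg _) (norm_outerNormal_le Ω x)

/-- Both sides vanish: `F` is `C¹` and compactly supported on the whole space, and it is zero on the
frontier. -/
theorem integral_fderiv_of_tsupport_subset {F : Space d → ℝ} (hF : HasCompactSupport F)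
    (hFΩ : tsupport F ⊆ Ω) (hd : ContDiffOn ℝ 1 F (closure Ω)) (w : Space d) :
    ∫ x in Ω, fderiv ℝ F x w = ∫ x, F x * inner ℝ w (outerNormal Ω x) ∂(surfaceMeasure Ω) := by
  have hdiff : ContDiff ℝ 1 F := by
    refine contDiff_iff_contDiffAt.2 fun x => ?_
    by_cases hx : x ∈ tsupport F
    · exact hΩ.contDiffAt hd (hFΩ hx)
    · exact contDiffAt_const.congr_of_eventuallyEq (notMem_tsupport_iff_eventuallyEq.1 hx)
  have h1 : ∫ x in Ω, fderiv ℝ F x w = 0 := by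
    rw [setIntegral_eq_integral_of_forall_compl_eq_zero]
    · obtain ⟨C, hC⟩ := exists_lipschitzWith_of_hasCompactSupport hdiff.locallyLipschitz hF
      rw [← integral_lineDeriv_eq_zero hC hF w]
      refine integral_congr_ae (Eventually.of_forall fun x => ?_)
      exact ((hdiff.differentiable (by norm_num) x).lineDeriv_eq_fderiv).symm
    · intro x hx
      have : fderiv ℝ F x = 0 := by
        by_contra h
        exact hx (hFΩ (support_fderiv_subset ℝ h))
      simp [this]
  rw [h1, surfaceMeasure, setIntegral_eq_zero_of_forall_eq_zero]
  intro x hx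
  rw [hΩ.isOpen.frontier_eq] at hx
  rw [image_eq_zero_of_notMem_tsupport fun h => hx.2 (hFΩ h), zero_mul]

theorem integral_fderiv_of_isLipschitzChart {U : Set (Space d)}
    {R : Space d ≃ₗᵢ[ℝ] WithLp 2 (Space (d - 1) × ℝ)} {g : Space (d - 1) → ℝ} {K : ℝ≥0}
    (h : IsLipschitzChart Ω U R g K) {F : Space d → ℝ} (hF : HasCompactSupport F)
    (hFU : tsupport F ⊆ U) (hd : ContDiffOn ℝ 1 F (closure Ω)) (w : Space d) :
    ∫ x in Ω, fderiv ℝ F x w = ∫ x, F x * inner ℝ w (outerNormal Ω x) ∂(surfaceMeasure Ω) := by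
  -- Nothing is assumed about `F` off `closure Ω`, so those values are discarded. The support lies
  -- in `U`, where `Ω` and the subgraph coincide, hence `F'` is `C¹` on the entire subgraph.
  set F' : Space d → ℝ := (closure Ω).indicator F with hF'
  have hts : tsupport F' ⊆ tsupport F := closure_mono (by
    rw [hF', support_indicator]; exact inter_subset_right)
  have hF'c : HasCompactSupport F' := hF.of_isClosed_subset (isClosed_tsupport _) hts
  have hloc : ∀ x ∈ Ω, F' =ᶠ[𝓝 x] F := fun x hx => by
    filter_upwards [hΩ.isOpen.mem_nhds hx] with z hz
    exact indicator_of_mem (subset_closure hz) F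
  have hout : ∀ x ∉ U, F' =ᶠ[𝓝 x] fun _ => 0 := fun x hx =>
    notMem_tsupport_iff_eventuallyEq.1 fun hx' => hx (hFU (hts hx'))
  have hd' : ContDiffOn ℝ 1 F' (subgraph R g) := by
    intro x hx
    refine ContDiffAt.contDiffWithinAt ?_
    by_cases hxU : x ∈ U
    · have hxΩ := (h.mem_iff hxU).2 hx
      exact (hΩ.contDiffAt hd hxΩ).congr_of_eventuallyEq (hloc x hxΩ)
    · exact contDiffAt_const.congr_of_eventuallyEq (hout x hxU)
  obtain ⟨C, hC⟩ := hΩ.isCompact_closure.exists_bound_of_continuousOn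
    (hd.continuousOn_fderivWithin hΩ.uniqueDiffOn (by norm_num))
  have hb : ∀ x ∈ subgraph R g, ‖fderiv ℝ F' x‖ ≤ max C 0 := by
    intro x hx
    by_cases hxU : x ∈ U
    · have hxΩ := (h.mem_iff hxU).2 hx
      rw [(hloc x hxΩ).fderiv_eq, ← hΩ.fderivWithin_eq hxΩ]
      exact (hC x (subset_closure hxΩ)).trans (le_max_left _ _)
    · rw [(hout x hxU).fderiv_eq]
      simp
  have hc : ∀ y, ContinuousWithinAt (fun r => F' (graphCoord R g (y, r))) (Iic 0) 0 := by
    intro y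
    have hcont : Continuous fun r : ℝ => graphCoord R g (y, r) :=
      (continuous_graphCoord R h.lipschitz.continuous).comp (Continuous.prodMk_right y)
    by_cases hyU : graphCoord R g (y, 0) ∈ U
    · have hmemF : graphCoord R g (y, 0) ∈ frontier Ω := by
        have : graphCoord R g (y, 0) ∈ range (graphParam R g) ∩ U :=
          ⟨⟨y, (graphCoord_zero R g y).symm⟩, hyU⟩
        rw [← h.frontier_inter] at this
        exact this.1
      have hcl : ∀ᶠ r in 𝓝[≤] (0 : ℝ), graphCoord R g (y, r) ∈ closure Ω := by
        have h1 : ∀ᶠ r in 𝓝[≤] (0 : ℝ), graphCoord R g (y, r) ∈ U :=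
          nhdsWithin_le_nhds (hcont.continuousAt.preimage_mem_nhds (h.isOpen.mem_nhds hyU))
        filter_upwards [h1, self_mem_nhdsWithin] with r hrU hr
        rcases (mem_Iic.1 hr).eq_or_lt with rfl | hr0
        · exact frontier_subset_closure hmemF
        · exact subset_closure ((h.mem_iff hrU).2 ((graphCoord_mem_subgraph R).2 hr0))
      have h2 : Tendsto (fun r => graphCoord R g (y, r)) (𝓝[≤] (0 : ℝ))
          (𝓝[closure Ω] (graphCoord R g (y, 0))) :=
        tendsto_nhdsWithin_iff.2 ⟨hcont.continuousAt.tendsto.mono_left nhdsWithin_le_nhds, hcl⟩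
      have h3 := (hd.continuousOn _ (frontier_subset_closure hmemF)).tendsto.comp h2
      rw [ContinuousWithinAt]
      simp only [hF', indicator_of_mem (frontier_subset_closure hmemF)]
      refine h3.congr' ?_
      filter_upwards [hcl] with r hr
      exact (indicator_of_mem hr F).symm
    · have h1 : (fun r => F' (graphCoord R g (y, r))) =ᶠ[𝓝 0] fun _ => 0 :=
        hcont.continuousAt.eventually (hout _ hyU)
      exact (continuousAt_const.congr h1.symm).continuousWithinAt
  have key := integral_subgraph_fderiv R h.lipschitz hF'c hd' hb hc w
  have hzero : ∀ x ∉ U, fderiv ℝ F x w = 0 := fun x hx => by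
    have : fderiv ℝ F x = 0 := by
      by_contra h
      exact hx (hFU (support_fderiv_subset ℝ h))
    simp [this]
  have hzero' : ∀ x ∉ U, fderiv ℝ F' x w = 0 := fun x hx => by
    rw [(hout x hx).fderiv_eq]; simp
  have hΩU : Ω ∩ U = subgraph R g ∩ U := by
    ext x
    exact and_congr_left fun hx => h.mem_iff hx
  have hUm := h.isOpen.measurableSet
  have hL : ∫ x in Ω, fderiv ℝ F x w = ∫ x in subgraph R g, fderiv ℝ F' x w := by
    rw [setIntegral_eq_of_subset_of_forall_sdiff_eq_zero hΩ.isOpen.measurableSet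
        (inter_subset_left (t := U)) fun x hx => hzero x fun hxU => hx.2 ⟨hx.1, hxU⟩,
      setIntegral_eq_of_subset_of_forall_sdiff_eq_zero
        (isOpen_subgraph R h.lipschitz.continuous).measurableSet
        (inter_subset_left (t := U)) fun x hx => hzero' x fun hxU => hx.2 ⟨hx.1, hxU⟩, ← hΩU]
    refine setIntegral_congr_fun (hΩ.isOpen.measurableSet.inter hUm) fun x hx => ?_
    simp only [(hloc x hx.1).fderiv_eq]
  rw [hL, key, surfaceMeasure, h.integral_frontier_eq]
  · refine integral_congr_ae ?_
    filter_upwards [h.lipschitz.ae_differentiableAt] with y hy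
    by_cases hyU : graphParam R g y ∈ U
    · have hmemF : graphParam R g y ∈ frontier Ω := by
        have : graphParam R g y ∈ range (graphParam R g) ∩ U := ⟨⟨y, rfl⟩, hyU⟩
        rw [← h.frontier_inter] at this
        exact this.1
      have hJ : graphDensity g y ≠ 0 := by linarith [one_le_graphDensity g y]
      rw [h.outerNormal_eq hy hyU, inner_graphNormal, hF',
        indicator_of_mem (frontier_subset_closure hmemF), smul_eq_mul]
      field_simp
    · rw [image_eq_zero_of_notMem_tsupport fun hx' => hyU (hFU (hts hx')),
        image_eq_zero_of_notMem_tsupport fun hx' => hyU (hFU hx')]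
      simp
  · intro x hx
    rw [image_eq_zero_of_notMem_tsupport fun hx' => hx (hFU hx'), zero_mul]

theorem exists_nhds_integral_fderiv {x : Space d} (hx : x ∈ closure Ω) :
    ∃ V : Set (Space d), IsOpen V ∧ x ∈ V ∧ ∀ F : Space d → ℝ, tsupport F ⊆ V →
      ContDiffOn ℝ 1 F (closure Ω) → ∀ w,
      ∫ x in Ω, fderiv ℝ F x w = ∫ x, F x * inner ℝ w (outerNormal Ω x) ∂(surfaceMeasure Ω) := by
  have hcs : ∀ F : Space d → ℝ, tsupport F ⊆ Metric.ball x 1 → HasCompactSupport F := fun F hF =>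
    (isCompact_closedBall x 1).of_isClosed_subset (isClosed_tsupport F)
      (hF.trans Metric.ball_subset_closedBall)
  by_cases hxΩ : x ∈ Ω
  · refine ⟨Ω ∩ Metric.ball x 1, hΩ.isOpen.inter Metric.isOpen_ball,
      ⟨hxΩ, Metric.mem_ball_self one_pos⟩, fun F hF hd w => ?_⟩
    exact hΩ.integral_fderiv_of_tsupport_subset (hcs F (hF.trans inter_subset_right))
      (hF.trans inter_subset_left) hd w
  · have hxf : x ∈ frontier Ω := by
      rw [hΩ.isOpen.frontier_eq]
      exact ⟨hx, hxΩ⟩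
    obtain ⟨U, R, g, K, hxU, h⟩ := hΩ.exists_chart hxf
    refine ⟨U ∩ Metric.ball x 1, h.isOpen.inter Metric.isOpen_ball,
      ⟨hxU, Metric.mem_ball_self one_pos⟩, fun F hF hd w => ?_⟩
    exact hΩ.integral_fderiv_of_isLipschitzChart h (hcs F (hF.trans inter_subset_right))
      (hF.trans inter_subset_left) hd w

/-- The Gauss–Green formula on a bounded Lipschitz domain. -/
theorem integral_fderivWithin {f : Space d → ℝ} (hf : ContDiffOn ℝ 1 f (closure Ω)) (w : Space d) :
    ∫ x in Ω, fderivWithin ℝ f (closure Ω) x w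
      = ∫ x, f x * inner ℝ w (outerNormal Ω x) ∂(surfaceMeasure Ω) := by
  choose! V hVo hxV hV using fun x (hx : x ∈ closure Ω) => hΩ.exists_nhds_integral_fderiv hx
  obtain ⟨t, htΩ, htc⟩ := hΩ.isCompact_closure.elim_nhds_subcover V
    fun x hx => (hVo x hx).mem_nhds (hxV x hx)
  -- The formula is linear in `f`, so it suffices to prove it for each `χ i * f`, which is supported
  -- in one of the local neighbourhoods.
  obtain ⟨χ, hχ⟩ := SmoothPartitionOfUnity.exists_isSubordinate
    (modelWithCornersSelf ℝ (Space d)) isClosed_closure (fun i : t => V i)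
    (fun i => hVo _ (htΩ i i.2)) (by simpa [iUnion_subtype] using htc)
  have hχd : ∀ i, ContDiffOn ℝ 1 (fun x => χ i x * f x) (closure Ω) := fun i =>
    (((χ i).contMDiff.contDiff.of_le (by simp)).contDiffOn).mul hf
  have hsum : ∀ x ∈ closure Ω, ∑ i, χ i x * f x = f x := fun x hx => by
    rw [← Finset.sum_mul, ← finsum_eq_sum_of_fintype, χ.sum_eq_one hx, one_mul]
  have hderiv : ∀ x ∈ Ω, fderivWithin ℝ f (closure Ω) x w
      = ∑ i, fderivWithin ℝ (fun x => χ i x * f x) (closure Ω) x w := fun x hx => by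
    have hx' := subset_closure hx
    rw [← fderivWithin_congr (fun y hy => hsum y hy) (hsum x hx'),
      fderivWithin_fun_sum (hΩ.uniqueDiffOn x hx')
        fun i _ => (hχd i).differentiableOn (by norm_num) x hx']
    simp
  rw [setIntegral_congr_fun hΩ.isOpen.measurableSet hderiv, integral_finsetSum _ fun i _ =>
    hΩ.integrableOn (hΩ.continuousOn_fderivWithin (hχd i) w)]
  have hpiece : ∀ i, ∫ x in Ω, fderivWithin ℝ (fun x => χ i x * f x) (closure Ω) x w
      = ∫ x, (χ i x * f x) * inner ℝ w (outerNormal Ω x) ∂(surfaceMeasure Ω) := fun i => by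
    rw [← hV i (htΩ i i.2) _ ((tsupport_mul_subset_left).trans (hχ i)) (hχd i) w]
    exact setIntegral_congr_fun hΩ.isOpen.measurableSet fun x hx => by
      simp only [hΩ.fderivWithin_eq hx]
  rw [Finset.sum_congr rfl fun i _ => hpiece i, ← integral_finsetSum _ fun i _ =>
    hΩ.integrable_inner_outerNormal w (hχd i).continuousOn]
  refine setIntegral_congr_fun isClosed_frontier.measurableSet fun x hx => ?_
  rw [← Finset.sum_mul, hsum x (frontier_subset_closure hx)]

/-- The Gauss–Green formula for vector-valued functions. -/
theorem integral_fderivWithin_vector {H : Type*} [NormedAddCommGroup H] [InnerProductSpace ℝ H]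
    [CompleteSpace H] {f : Space d → H} (hf : ContDiffOn ℝ 1 f (closure Ω)) (w : Space d) :
    Integrable (fun x => (inner ℝ w (outerNormal Ω x) : ℝ) • f x) (surfaceMeasure Ω) ∧
    ∫ x in Ω, fderivWithin ℝ f (closure Ω) x w
      = ∫ x, (inner ℝ w (outerNormal Ω x) : ℝ) • f x ∂(surfaceMeasure Ω) := by
  have hint : Integrable (fun x => (inner ℝ w (outerNormal Ω x) : ℝ) • f x) (surfaceMeasure Ω) := by
    refine (hΩ.integrable_surface hf.continuousOn).bdd_smul (C := ‖w‖)
      (hΩ.aestronglyMeasurable_outerNormal.const_inner) (Eventually.of_forall fun x => ?_)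
    refine (norm_inner_le_norm _ _).trans ?_
    exact mul_le_of_le_one_right (norm_nonneg _) (norm_outerNormal_le Ω x)
  -- Pairing with a fixed vector `c` reduces the identity to the scalar formula.
  refine ⟨hint, ext_inner_left ℝ fun c => ?_⟩
  rw [← integral_inner (hΩ.integrableOn (hΩ.continuousOn_fderivWithin hf w)), ← integral_inner hint]
  have hc : ContDiffOn ℝ 1 (fun x => inner ℝ c (f x)) (closure Ω) := contDiffOn_const.inner ℝ hf
  have hd : ∀ x ∈ Ω, inner ℝ c (fderivWithin ℝ f (closure Ω) x w)
      = fderivWithin ℝ (fun x => (inner ℝ c (f x) : ℝ)) (closure Ω) x w := fun x hx => by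
    have hx' := subset_closure hx
    have h1 := (innerSL ℝ c).hasFDerivAt.comp_hasFDerivWithinAt x
      (hf.differentiableOn (by norm_num) x hx').hasFDerivWithinAt
    have h2 : fderivWithin ℝ (fun x => (inner ℝ c (f x) : ℝ)) (closure Ω) x = _ :=
      h1.fderivWithin (hΩ.uniqueDiffOn x hx')
    rw [h2]
    simp
  rw [setIntegral_congr_fun hΩ.isOpen.measurableSet hd, hΩ.integral_fderivWithin hc]
  simp_rw [inner_smul_right, mul_comm]

end IsBoundedLipschitzDomain

/-! ### Differentiation in time -/

namespace IsBoundedLipschitzDomain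

variable {Ω : Set (Space d)} (hΩ : IsBoundedLipschitzDomain Ω)
  {E : Type*} [NormedAddCommGroup E] [NormedSpace ℝ E]

include hΩ

theorem hasDerivAt_integral {u u' : ℝ → Space d → E} {t δ C : ℝ} (hδ : 0 < δ)
    (hu : ∀ s ∈ Metric.ball t δ, ContinuousOn (u s) (closure Ω))
    (hd : ∀ s ∈ Metric.ball t δ, ∀ x ∈ closure Ω, HasDerivAt (fun r => u r x) (u' s x) s)
    (hc : ContinuousOn (u' t) (closure Ω))
    (hb : ∀ s ∈ Metric.ball t δ, ∀ x ∈ closure Ω, ‖u' s x‖ ≤ C) :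
    HasDerivAt (fun s => ∫ x in Ω, u s x) (∫ x in Ω, u' t x) t := by
  have hball := Metric.ball_mem_nhds t hδ
  have hC : IntegrableOn (fun _ : Space d => C) Ω := hΩ.integrableOn continuousOn_const
  have hmem := ae_restrict_mem (μ := volume) hΩ.isOpen.measurableSet
  refine (hasDerivAt_integral_of_dominated_loc_of_deriv_le (bound := fun _ => C) hball
    (eventually_of_mem hball fun s hs => (hΩ.integrableOn (hu s hs)).aestronglyMeasurable)
    (hΩ.integrableOn (hu t (mem_of_mem_nhds hball)))
    (hΩ.integrableOn hc).aestronglyMeasurable ?_ hC ?_).2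
  · filter_upwards [hmem] with x hx s hs using hb s hs x (subset_closure hx)
  · filter_upwards [hmem] with x hx s hs using hd s hs x (subset_closure hx)

/-- Joint continuity is available for the time derivative only. It bounds that derivative on a
compact cylinder, and the mean value inequality starting from time `t` then bounds `u` itself.
Stating it for all small `δ` allows bounds for `φ` and `v` to share one radius. -/
theorem exists_local_bound {T : ℝ} {u : ℝ → Space d → E}
    (hu : ∀ t ∈ Ioo 0 T, ContinuousOn (u t) (closure Ω))
    (hd : ∀ x ∈ closure Ω, DifferentiableOn ℝ (fun t => u t x) (Ioo 0 T))
    (hc : ContinuousOn (fun z : ℝ × Space d => deriv (fun t => u t z.2) z.1)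
      (Ioo 0 T ×ˢ closure Ω)) {t : ℝ} (ht : t ∈ Ioo 0 T) :
    ∃ C, 0 ≤ C ∧ ∀ᶠ δ in 𝓝[>] (0 : ℝ), Metric.ball t δ ⊆ Ioo 0 T ∧ ∀ s ∈ Metric.ball t δ,
      ∀ x ∈ closure Ω, ‖u s x‖ ≤ C ∧ ‖deriv (fun r => u r x) s‖ ≤ C := by
  obtain ⟨δ, hδ, hδT⟩ := Metric.nhds_basis_closedBall.mem_iff.1 (isOpen_Ioo.mem_nhds ht)
  have hK : IsCompact (Metric.closedBall t δ ×ˢ closure Ω) :=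
    (isCompact_closedBall t δ).prod hΩ.isCompact_closure
  obtain ⟨M, hM⟩ := hK.exists_bound_of_continuousOn (hc.mono (prod_mono hδT subset_rfl))
  obtain ⟨M', hM'⟩ := hΩ.isCompact_closure.exists_bound_of_continuousOn (hu t ht)
  have hM1 : ∀ s ∈ Metric.closedBall t δ, ∀ x ∈ closure Ω, ‖deriv (fun r => u r x) s‖ ≤ max M 0 :=
    fun s hs x hx => (hM (s, x) ⟨hs, hx⟩).trans (le_max_left _ _)
  refine ⟨max M' 0 + max M 0 * δ + max M 0, by positivity, ?_⟩
  filter_upwards [Ioo_mem_nhdsGT hδ] with δ' hδ'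
  have hsub : Metric.ball t δ' ⊆ Metric.closedBall t δ :=
    (Metric.ball_subset_ball hδ'.2.le).trans Metric.ball_subset_closedBall
  refine ⟨hsub.trans hδT, fun s hs x hx => ?_⟩
  have h1 := hM1 s (hsub hs) x hx
  have h2 : ‖u s x - u t x‖ ≤ max M 0 * ‖s - t‖ :=
    (convex_closedBall t δ).norm_image_sub_le_of_norm_hasDerivWithin_le (f := fun r => u r x)
      (fun r hr => ((hd x hx).differentiableAt
        (isOpen_Ioo.mem_nhds (hδT hr))).hasDerivAt.hasDerivWithinAt)
      (fun r hr => hM1 r hr x hx) (Metric.mem_closedBall_self hδ.le) (hsub hs)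
  have h3 : ‖s - t‖ ≤ δ := by
    rw [← dist_eq_norm]; exact hsub hs
  have h4 : max M 0 * ‖s - t‖ ≤ max M 0 * δ := by gcongr
  have h5 := (hM' x hx).trans (le_max_left M' 0)
  have h6 := norm_sub_norm_le (u s x) (u t x)
  have h7 := le_max_right M 0
  have h8 := le_max_right M' 0
  constructor
  · linarith
  · nlinarith [mul_nonneg h7 hδ.le]

theorem integral_fderivWithin_eq_zero {H : Type*} [NormedAddCommGroup H] [InnerProductSpace ℝ H]
    [CompleteSpace H] {f : Space d → H} (hf : ContDiffOn ℝ 1 f (closure Ω))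
    (h0 : ∀ x ∈ frontier Ω, f x = 0) (w : Space d) :
    ∫ x in Ω, fderivWithin ℝ f (closure Ω) x w = 0 := by
  rw [(hΩ.integral_fderivWithin_vector hf w).2]
  exact setIntegral_eq_zero_of_forall_eq_zero fun x hx => by rw [h0 x hx, smul_zero]

theorem integral_dvg_eq_zero {f : Space d → Space d} (hf : ContDiffOn ℝ 1 f (closure Ω))
    (h0 : ∀ x ∈ frontier Ω, f x = 0) : ∫ x in Ω, dvg Ω f x = 0 := by
  have hint : ∀ w, IntegrableOn (fun x => fderivWithin ℝ f (closure Ω) x w) Ω := fun w =>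
    hΩ.integrableOn (hΩ.continuousOn_fderivWithin hf w)
  have hi : ∀ i : Fin d, ∫ x in Ω, (fderivWithin ℝ f (closure Ω) x (EuclideanSpace.single i 1)) i
      = 0 := fun i => by
    have := (EuclideanSpace.proj i : Space d →L[ℝ] ℝ).integral_comp_comm
      (hint (EuclideanSpace.single i 1))
    rw [hΩ.integral_fderivWithin_eq_zero hf h0] at this
    simpa using this
  unfold dvg
  refine (integral_finsetSum _ fun i _ => (EuclideanSpace.proj i : Space d →L[ℝ] ℝ).integrable_comp
    (hint (EuclideanSpace.single i 1))).trans ?_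
  exact Finset.sum_eq_zero fun i _ => hi i

end IsBoundedLipschitzDomain

/-! ### Differential identities -/

section Calculus

variable {Ω : Set (Space d)} {x : Space d}

theorem sum_inner_single_smul (a : Space d) :
    ∑ i, (inner ℝ a (EuclideanSpace.single i (1 : ℝ)) : ℝ) • EuclideanSpace.single i (1 : ℝ) = a := by
  have := (EuclideanSpace.basisFun (Fin d) ℝ).sum_repr' a
  simpa [EuclideanSpace.inner_single_right, EuclideanSpace.inner_single_left] using this

theorem dvg_smul {f : Space d → ℝ} {F : Space d → Space d}
    (hs : UniqueDiffWithinAt ℝ (closure Ω) x)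
    (hf : DifferentiableWithinAt ℝ f (closure Ω) x)
    (hF : DifferentiableWithinAt ℝ F (closure Ω) x) :
    dvg Ω (fun y => f y • F y) x
      = fderivWithin ℝ f (closure Ω) x (F x) + f x * dvg Ω F x := by
  have hFx : F x = ∑ i, F x i • EuclideanSpace.single i (1 : ℝ) := by
    conv_lhs => rw [← sum_inner_single_smul (F x)]
    simp [EuclideanSpace.inner_single_right]
  conv_rhs => rw [hFx, map_sum]
  simp only [dvg, jacobian, fderivWithin_fun_smul hs hf hF, map_smul, Finset.mul_sum,
    ← Finset.sum_add_distrib]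
  refine Finset.sum_congr rfl fun i _ => ?_
  simp
  ring

theorem hasFDerivWithinAt_grad {f : Space d → ℝ}
    (hf : DifferentiableWithinAt ℝ f (closure Ω) x) :
    HasFDerivWithinAt f (innerSL ℝ (grad Ω f x)) (closure Ω) x := by
  have h : innerSL ℝ (grad Ω f x) = fderivWithin ℝ f (closure Ω) x := by
    ext w
    simp [grad, gradientWithin]
  rw [h]
  exact hf.hasFDerivWithinAt

theorem contDiffOn_grad {n : WithTop ℕ∞} {f : Space d → ℝ} (hs : UniqueDiffOn ℝ (closure Ω))
    (hf : ContDiffOn ℝ (n + 1) f (closure Ω)) : ContDiffOn ℝ n (grad Ω f) (closure Ω) :=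
  (InnerProductSpace.toDual ℝ (Space d)).symm.contDiff.comp_contDiffOn
    (hf.fderivWithin hs le_rfl)

theorem lapl_eq_sum {F : Type*} [NormedAddCommGroup F] [NormedSpace ℝ F] {f : Space d → F}
    (hs : UniqueDiffOn ℝ (closure Ω)) (hx : x ∈ closure Ω) :
    lapl Ω f x = ∑ i, fderivWithin ℝ (fderivWithin ℝ f (closure Ω)) (closure Ω) x
      (EuclideanSpace.single i 1) (EuclideanSpace.single i 1) := by
  rw [lapl, InnerProductSpace.laplacianWithin_eq_iteratedFDerivWithin_orthonormalBasis f hs hx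
    (EuclideanSpace.basisFun (Fin d) ℝ)]
  refine Finset.sum_congr rfl fun i _ => ?_
  refine (iteratedFDerivWithin_two_apply f hs hx _).trans ?_
  simp

theorem contDiffOn_lapl {f : Space d → ℝ} (hs : UniqueDiffOn ℝ (closure Ω))
    (hf : ContDiffOn ℝ 3 f (closure Ω)) : ContDiffOn ℝ 1 (lapl Ω f) (closure Ω) := by
  refine ContDiffOn.congr ?_ fun x hx => lapl_eq_sum hs hx
  have h1 : ContDiffOn ℝ 2 (fderivWithin ℝ f (closure Ω)) (closure Ω) :=
    hf.fderivWithin hs (by norm_num)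
  have h2 : ContDiffOn ℝ 1 (fderivWithin ℝ (fderivWithin ℝ f (closure Ω)) (closure Ω))
      (closure Ω) := h1.fderivWithin hs (by norm_num)
  exact ContDiffOn.sum fun i _ => (h2.clm_apply contDiffOn_const).clm_apply contDiffOn_const

theorem fderivWithin_apply_const {F G : Type*} [NormedAddCommGroup F] [NormedSpace ℝ F]
    [NormedAddCommGroup G] [NormedSpace ℝ G] {L : Space d → F →L[ℝ] G}
    (hs : UniqueDiffWithinAt ℝ (closure Ω) x)
    (hL : DifferentiableWithinAt ℝ L (closure Ω) x) (a : F) (w : Space d) :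
    fderivWithin ℝ (fun y => L y a) (closure Ω) x w = fderivWithin ℝ L (closure Ω) x w a := by
  rw [fderivWithin_clm_apply hs hL (differentiableWithinAt_const a)]
  simp

/-- The Riesz isometry is linear and commutes with differentiation, so the derivative of the
gradient is the Hessian form. -/
theorem inner_fderivWithin_grad {f : Space d → ℝ} (hs : UniqueDiffWithinAt ℝ (closure Ω) x)
    (hf : DifferentiableWithinAt ℝ (fderivWithin ℝ f (closure Ω)) (closure Ω) x) (a b : Space d) :
    inner ℝ (fderivWithin ℝ (grad Ω f) (closure Ω) x a) b
      = fderivWithin ℝ (fderivWithin ℝ f (closure Ω)) (closure Ω) x a b := by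
  have h : HasFDerivWithinAt (grad Ω f) _ (closure Ω) x :=
    (InnerProductSpace.toDual ℝ (Space d)).symm.toContinuousLinearEquiv.toContinuousLinearMap
      |>.hasFDerivAt.comp_hasFDerivWithinAt x hf.hasFDerivWithinAt
  rw [h.fderivWithin hs]
  simp

end Calculus

/-! ### The momentum tensor -/

theorem Parameters.contDiff_p (P : Parameters) : ContDiff ℝ 1 P.p := by
  have h : ContDiff ℝ 1 (deriv P.W) := P.W_contDiff.deriv'
  exact (contDiff_id.mul h).sub (P.W_contDiff.of_le (by norm_num))

section Tensor

variable (P : Parameters) (Ω : Set (Space d)) (φ : Space d → ℝ) (v : Space d → Space d)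
  (lam : Space d → ℝ)

/-- The isotropic part of the momentum flux. -/
def totalPressure (x : Space d) : ℝ :=
  P.p (φ x) + lam x - P.γ * (φ x * lapl Ω φ x) - P.γ / 2 * ‖grad Ω φ x‖ ^ 2

/-- The momentum flux through a surface element with normal `w`, including the Korteweg stress. -/
def momentumTensor (w x : Space d) : Space d :=
  totalPressure P Ω φ lam x • w + P.γ • ((inner ℝ (grad Ω φ x) w : ℝ) • grad Ω φ x)
    - P.η • jacobian Ω v x w

variable {P Ω φ v lam}

theorem contDiffOn_totalPressure (hs : UniqueDiffOn ℝ (closure Ω))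
    (hφ : ContDiffOn ℝ 3 φ (closure Ω)) (hlam : ContDiffOn ℝ 1 lam (closure Ω)) :
    ContDiffOn ℝ 1 (totalPressure P Ω φ lam) (closure Ω) := by
  have hφ1 : ContDiffOn ℝ 1 φ (closure Ω) := hφ.of_le (by norm_num)
  have hN : ContDiffOn ℝ 1 (grad Ω φ) (closure Ω) := contDiffOn_grad hs (hφ.of_le (by norm_num))
  exact (((P.contDiff_p.comp_contDiffOn hφ1).add hlam).sub
    (contDiffOn_const.mul (hφ1.mul (contDiffOn_lapl hs hφ)))).sub
    (contDiffOn_const.mul (hN.norm_sq ℝ))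

theorem contDiffOn_momentumTensor (hs : UniqueDiffOn ℝ (closure Ω))
    (hφ : ContDiffOn ℝ 3 φ (closure Ω)) (hv : ContDiffOn ℝ 2 v (closure Ω))
    (hlam : ContDiffOn ℝ 1 lam (closure Ω)) (w : Space d) :
    ContDiffOn ℝ 1 (momentumTensor P Ω φ v lam w) (closure Ω) := by
  have hN : ContDiffOn ℝ 1 (grad Ω φ) (closure Ω) := contDiffOn_grad hs (hφ.of_le (by norm_num))
  have hJ : ContDiffOn ℝ 1 (jacobian Ω v) (closure Ω) := hv.fderivWithin hs (by norm_num)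
  have h1 : ContDiffOn ℝ 1 (fun x => totalPressure P Ω φ lam x • w) (closure Ω) :=
    (contDiffOn_totalPressure hs hφ hlam).smul contDiffOn_const
  have h2 : ContDiffOn ℝ 1 (fun x => (inner ℝ (grad Ω φ x) w : ℝ) • grad Ω φ x) (closure Ω) :=
    (hN.inner ℝ contDiffOn_const).smul hN
  have h3 : ContDiffOn ℝ 1 (fun x => jacobian Ω v x w) (closure Ω) := hJ.clm_apply contDiffOn_const
  exact (h1.add (h2.const_smul P.γ)).sub (h3.const_smul P.η)

theorem hasFDerivWithinAt_totalPressure {x : Space d} (hΩ : IsOpen Ω)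
    (hs : UniqueDiffOn ℝ (closure Ω)) (hx : x ∈ Ω)
    (hφ : ContDiffOn ℝ 3 φ (closure Ω)) (hlam : ContDiffOn ℝ 1 lam (closure Ω)) :
    HasFDerivWithinAt (totalPressure P Ω φ lam)
      (innerSL ℝ (grad Ω (fun y => P.p (φ y) + lam y) x
        - P.γ • (φ x • grad Ω (fun y => lapl Ω φ y) x + lapl Ω φ x • grad Ω φ x)
        - P.γ • fderivWithin ℝ (grad Ω φ) (closure Ω) x (grad Ω φ x))) (closure Ω) x := by
  have hx' := subset_closure hx
  have hφ1 : ContDiffOn ℝ 1 φ (closure Ω) := hφ.of_le (by norm_num)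
  have hN : ContDiffOn ℝ 1 (grad Ω φ) (closure Ω) := contDiffOn_grad hs (hφ.of_le (by norm_num))
  have hD : ContDiffOn ℝ 1 (fderivWithin ℝ φ (closure Ω)) (closure Ω) :=
    hφ.fderivWithin hs (by norm_num)
  have h1 := hasFDerivWithinAt_grad
    (((P.contDiff_p.comp_contDiffOn hφ1).add hlam).differentiableOn (by norm_num) x hx')
  have h2 := hasFDerivWithinAt_grad (hφ1.differentiableOn (by norm_num) x hx')
  have h3 := hasFDerivWithinAt_grad
    ((contDiffOn_lapl hs hφ).differentiableOn (by norm_num) x hx')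
  have h4 := (hN.differentiableOn (by norm_num) x hx').hasFDerivWithinAt.norm_sq
  -- Symmetry of the Hessian is what turns the differential of `|∇φ|²/2` into the vector `D²φ ∇φ`.
  have hsymm : ∀ a b, fderivWithin ℝ (fderivWithin ℝ φ (closure Ω)) (closure Ω) x a b
      = fderivWithin ℝ (fderivWithin ℝ φ (closure Ω)) (closure Ω) x b a :=
    (hφ x hx').isSymmSndFDerivWithinAt (by simp; norm_num) hs
      (closure_mono (hΩ.subset_interior_iff.2 subset_closure) hx') hx'
  refine (((h1.sub ((h2.mul h3).const_mul P.γ)).sub (h4.const_mul (P.γ / 2)))).congr_fderiv ?_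
  ext w
  have h5 : inner ℝ (grad Ω φ x) (fderivWithin ℝ (grad Ω φ) (closure Ω) x w)
      = inner ℝ (fderivWithin ℝ (grad Ω φ) (closure Ω) x (grad Ω φ x)) w := by
    rw [real_inner_comm, inner_fderivWithin_grad (hs x hx') (hD.differentiableOn (by norm_num) x hx'),
      inner_fderivWithin_grad (hs x hx') (hD.differentiableOn (by norm_num) x hx'), hsymm]
  simp [h5]
  ring

/-- The Korteweg term contributes `γ (D²φ ∇φ + Δφ ∇φ)`. This cancels against the gradients of `-γ φ
Δφ` and `-(γ/2)|∇φ|²` except for `-γ φ ∇Δφ`, the capillary force. -/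
theorem sum_fderivWithin_momentumTensor {x : Space d} (hΩ : IsOpen Ω)
    (hs : UniqueDiffOn ℝ (closure Ω)) (hx : x ∈ Ω)
    (hφ : ContDiffOn ℝ 3 φ (closure Ω)) (hv : ContDiffOn ℝ 2 v (closure Ω))
    (hlam : ContDiffOn ℝ 1 lam (closure Ω)) :
    ∑ i, fderivWithin ℝ (momentumTensor P Ω φ v lam (EuclideanSpace.single i 1)) (closure Ω) x
        (EuclideanSpace.single i 1)
      = grad Ω (fun y => P.p (φ y) + lam y) x - P.η • lapl Ω v x
        - (P.γ * φ x) • grad Ω (fun y => lapl Ω φ y) x := by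
  have hx' := subset_closure hx
  have hN : ContDiffOn ℝ 1 (grad Ω φ) (closure Ω) := contDiffOn_grad hs (hφ.of_le (by norm_num))
  have hD : ContDiffOn ℝ 1 (fderivWithin ℝ φ (closure Ω)) (closure Ω) :=
    hφ.fderivWithin hs (by norm_num)
  have hJ : ContDiffOn ℝ 1 (jacobian Ω v) (closure Ω) := hv.fderivWithin hs (by norm_num)
  have hA := hasFDerivWithinAt_totalPressure (P := P) hΩ hs hx hφ hlam
  set a := grad Ω (fun y => P.p (φ y) + lam y) x
    - P.γ • (φ x • grad Ω (fun y => lapl Ω φ y) x + lapl Ω φ x • grad Ω φ x)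
    - P.γ • fderivWithin ℝ (grad Ω φ) (closure Ω) x (grad Ω φ x) with ha
  have hNx := (hN.differentiableOn (by norm_num) x hx').hasFDerivWithinAt
  have hterm : ∀ w : Space d, fderivWithin ℝ (momentumTensor P Ω φ v lam w) (closure Ω) x w
      = (inner ℝ a w : ℝ) • w
        + P.γ • (fderivWithin ℝ (grad Ω φ) (closure Ω) x ((inner ℝ (grad Ω φ x) w : ℝ) • w)
          + fderivWithin ℝ (fderivWithin ℝ φ (closure Ω)) (closure Ω) x w w • grad Ω φ x)
        - P.η • fderivWithin ℝ (fderivWithin ℝ v (closure Ω)) (closure Ω) x w w := by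
    intro w
    have hJw : HasFDerivWithinAt (fun y => jacobian Ω v y w) _ (closure Ω) x :=
      ((hJ.clm_apply contDiffOn_const).differentiableOn (by norm_num) x hx').hasFDerivWithinAt
    have h := ((hA.smul_const w).add
      (((hNx.inner ℝ (hasFDerivWithinAt_const w x _)).smul hNx).const_smul P.γ)).sub
      (hJw.const_smul P.η)
    have h' : HasFDerivWithinAt (momentumTensor P Ω φ v lam w) _ (closure Ω) x := h
    rw [h'.fderivWithin (hs x hx')]
    simp [fderivWithin_apply_const (hs x hx') (hJ.differentiableOn (by norm_num) x hx'),
      inner_fderivWithin_grad (hs x hx') (hD.differentiableOn (by norm_num) x hx')]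
  simp_rw [hterm]
  rw [Finset.sum_sub_distrib, Finset.sum_add_distrib, sum_inner_single_smul, ← Finset.smul_sum,
    Finset.sum_add_distrib, ← map_sum, sum_inner_single_smul, ← Finset.sum_smul,
    ← lapl_eq_sum hs hx', ← Finset.smul_sum, ← lapl_eq_sum hs hx', ha]
  module

/-- The tensor is linear in its direction, so the sum evaluates it at the normal, where the Korteweg
stress carries the factor `∇φ · n = 0`. -/
theorem sum_inner_smul_momentumTensor {x : Space d}
    (h : inner ℝ (grad Ω φ x) (outerNormal Ω x) = 0) :
    ∑ i, (inner ℝ (EuclideanSpace.single i (1 : ℝ)) (outerNormal Ω x) : ℝ)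
        • momentumTensor P Ω φ v lam (EuclideanSpace.single i 1) x
      = momentumFlux P Ω φ v lam x := by
  have hlin : ∀ (c : ℝ) (w : Space d), c • momentumTensor P Ω φ v lam w x
      = totalPressure P Ω φ lam x • (c • w)
        + P.γ • ((inner ℝ (grad Ω φ x) (c • w) : ℝ) • grad Ω φ x)
        - P.η • jacobian Ω v x (c • w) := by
    intro c w
    rw [momentumTensor, inner_smul_right, map_smul]
    module
  simp_rw [hlin]
  rw [Finset.sum_sub_distrib, Finset.sum_add_distrib, ← Finset.smul_sum, ← Finset.smul_sum,
    ← Finset.smul_sum, ← map_sum, ← Finset.sum_smul, ← inner_sum]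
  have hn : ∑ i, (inner ℝ (EuclideanSpace.single i (1 : ℝ)) (outerNormal Ω x) : ℝ)
      • EuclideanSpace.single i (1 : ℝ) = outerNormal Ω x := by
    conv_rhs => rw [← sum_inner_single_smul (outerNormal Ω x)]
    simp_rw [real_inner_comm]
  rw [hn, h, zero_smul, smul_zero, add_zero]
  rfl

end Tensor

/-! ### Balance laws -/

theorem Parameters.ρ_eq (P : Parameters) (u : ℝ) :
    P.ρ u = (P.ρ₁ + P.ρ₂) / 2 + (P.ρ₁ - P.ρ₂) / 2 * u := by
  unfold Parameters.ρ; ring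

theorem Parameters.contDiff_ρ (P : Parameters) {n : WithTop ℕ∞} : ContDiff ℝ n P.ρ := by
  have : P.ρ = fun u => (P.ρ₁ + P.ρ₂) / 2 + (P.ρ₁ - P.ρ₂) / 2 * u := funext P.ρ_eq
  rw [this]
  fun_prop

theorem Parameters.mass_coefficients (P : Parameters) :
    (P.ρ₁ - P.ρ₂) / 2 * P.cPlus + (P.ρ₁ + P.ρ₂) / 2 * P.cMinus = 0 := by
  have h1 := P.ρ₁_pos.ne'
  have h2 := P.ρ₂_pos.ne'
  unfold Parameters.cPlus Parameters.cMinus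
  field_simp
  ring

/-- The product rule `div (m ⊗ v) = (m · ∇) v + (div m) v`, used with `m = ρ v`. -/
theorem sum_fderivWithin_smul {Ω : Set (Space d)} {x : Space d} {m v : Space d → Space d}
    (hs : UniqueDiffWithinAt ℝ (closure Ω) x)
    (hm : DifferentiableWithinAt ℝ m (closure Ω) x)
    (hv : DifferentiableWithinAt ℝ v (closure Ω) x) :
    ∑ i, fderivWithin ℝ (fun y => m y i • v y) (closure Ω) x (EuclideanSpace.single i 1)
      = jacobian Ω v x (m x) + dvg Ω m x • v x := by
  have hmx : m x = ∑ i, m x i • EuclideanSpace.single i (1 : ℝ) := by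
    conv_lhs => rw [← sum_inner_single_smul (m x)]
    simp [EuclideanSpace.inner_single_right]
  have hmi : ∀ i, HasFDerivWithinAt (fun y => m y i)
      ((EuclideanSpace.proj i : Space d →L[ℝ] ℝ) ∘L fderivWithin ℝ m (closure Ω) x)
      (closure Ω) x := fun i =>
    (EuclideanSpace.proj i : Space d →L[ℝ] ℝ).hasFDerivAt.comp_hasFDerivWithinAt x
      hm.hasFDerivWithinAt
  conv_rhs => rw [hmx, map_sum]
  rw [dvg, Finset.sum_smul, ← Finset.sum_add_distrib]
  refine Finset.sum_congr rfl fun i _ => ?_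
  have h : HasFDerivWithinAt (fun y => m y i • v y) _ (closure Ω) x :=
    (hmi i).smul hv.hasFDerivWithinAt
  rw [h.fderivWithin hs]
  simp

namespace IsStrongSolution

variable {P : Parameters} {Ω : Set (Space d)} {T : ℝ} {φ : ℝ → Space d → ℝ}
  {v : ℝ → Space d → Space d} {lam : ℝ → Space d → ℝ}

theorem mass_balance (hsol : IsStrongSolution P Ω T φ v lam) (hs : UniqueDiffOn ℝ (closure Ω))
    {t : ℝ} (ht : t ∈ Ioo 0 T) {x : Space d} (hx : x ∈ Ω) :
    (P.ρ₁ - P.ρ₂) / 2 * deriv (fun s => φ s x) t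
      = -dvg Ω (fun y => P.ρ (φ t y) • v t y) x := by
  have hx' := subset_closure hx
  have hφ : DifferentiableWithinAt ℝ (φ t) (closure Ω) x :=
    (hsol.φ_space t ht).differentiableOn (by norm_num) x hx'
  have hv : DifferentiableWithinAt ℝ (v t) (closure Ω) x :=
    (hsol.v_space t ht).differentiableOn (by norm_num) x hx'
  have hρ : HasFDerivWithinAt (fun y => P.ρ (φ t y))
      (((P.ρ₁ - P.ρ₂) / 2) • fderivWithin ℝ (φ t) (closure Ω) x) (closure Ω) x := by
    simp_rw [P.ρ_eq]
    exact (hφ.hasFDerivWithinAt.const_mul _).const_add _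
  have h1 := hsol.phase_eq t ht x hx
  have h2 := hsol.divergence_eq t ht x hx
  have h3 := P.mass_coefficients
  rw [dvg_smul (hs x hx') hφ hv] at h1
  rw [dvg_smul (hs x hx') hρ.differentiableWithinAt hv, hρ.fderivWithin (hs x hx'), P.ρ_eq]
  simp only [smul_apply, smul_eq_mul]
  -- The weights are the slope and the constant term of `ρ`; with them the common source of the two
  -- equations gets the coefficient zero.
  linear_combination ((P.ρ₁ - P.ρ₂) / 2) * h1 + ((P.ρ₁ + P.ρ₂) / 2) * h2
    + (P.mj * lapl Ω (P.q Ω (φ t) (lam t)) x - P.mr * P.q Ω (φ t) (lam t) x) * h3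

/-- By the continuity equation `(∂ₜρ) v` cancels the term `div (ρ v) v` of the convective flux, so
only `ρ (v · ∇) v` of the momentum equation remains. -/
theorem momentum_balance (hsol : IsStrongSolution P Ω T φ v lam) (hΩ : IsOpen Ω)
    (hs : UniqueDiffOn ℝ (closure Ω)) {t : ℝ} (ht : t ∈ Ioo 0 T) {x : Space d} (hx : x ∈ Ω) :
    ((P.ρ₁ - P.ρ₂) / 2 * deriv (fun s => φ s x) t) • v t x
        + P.ρ (φ t x) • deriv (fun s => v s x) t
      = -∑ i, (fderivWithin ℝ (fun y => (P.ρ (φ t y) • v t y) i • v t y) (closure Ω) x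
            (EuclideanSpace.single i 1)
          + fderivWithin ℝ (momentumTensor P Ω (φ t) (v t) (lam t) (EuclideanSpace.single i 1))
            (closure Ω) x (EuclideanSpace.single i 1)) := by
  have hx' := subset_closure hx
  have hv : DifferentiableWithinAt ℝ (v t) (closure Ω) x :=
    (hsol.v_space t ht).differentiableOn (by norm_num) x hx'
  have hρ : DifferentiableWithinAt ℝ (fun y => P.ρ (φ t y)) (closure Ω) x :=
    (P.contDiff_ρ.comp_contDiffOn (hsol.φ_space t ht)).differentiableOn (by norm_num) x hx'
  rw [Finset.sum_add_distrib, sum_fderivWithin_smul (m := fun y => P.ρ (φ t y) • v t y) (hs x hx')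
    (hρ.smul hv) hv, sum_fderivWithin_momentumTensor hΩ hs hx (hsol.φ_space t ht)
    (hsol.v_space t ht) (hsol.lam_space t ht), hsol.mass_balance hs ht hx, map_smul]
  have h := hsol.momentum_eq t ht x hx
  rw [smul_add] at h
  rw [← sub_eq_zero] at h ⊢
  rw [← h]
  module

theorem hasDerivAt_mass (hsol : IsStrongSolution P Ω T φ v lam)
    (hbc : SatisfiesBoundaryConditions P Ω T φ v lam) (hΩ : IsBoundedLipschitzDomain Ω)
    {t : ℝ} (ht : t ∈ Ioo 0 T) :
    HasDerivAt (fun s => ∫ x in Ω, P.ρ (φ s x)) 0 t := by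
  have hs := hΩ.uniqueDiffOn
  obtain ⟨C, hC, hev⟩ := hΩ.exists_local_bound (fun t ht => (hsol.φ_space t ht).continuousOn)
    hsol.φ_time hsol.φ_time_cont ht
  obtain ⟨δ, ⟨hδT, hb⟩, hδ⟩ := (hev.and self_mem_nhdsWithin).exists
  have hderiv := hΩ.hasDerivAt_integral (u := fun s x => P.ρ (φ s x))
    (u' := fun s x => (P.ρ₁ - P.ρ₂) / 2 * deriv (fun r => φ r x) s)
    (C := |(P.ρ₁ - P.ρ₂) / 2| * C) hδ
    (fun s hs => P.contDiff_ρ.continuous (n := 0) |>.comp_continuousOn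
      (hsol.φ_space s (hδT hs)).continuousOn)
    (fun s hs x hx => by
      simp_rw [P.ρ_eq]
      exact ((((hsol.φ_time x hx).differentiableAt
        (isOpen_Ioo.mem_nhds (hδT hs))).hasDerivAt).const_mul _).const_add _)
    (continuousOn_const.mul (hsol.φ_time_cont.comp (Continuous.prodMk_right t).continuousOn
      fun x hx => ⟨ht, hx⟩))
    (fun s hs x hx => by
      rw [norm_mul, Real.norm_eq_abs]
      gcongr
      exact (hb s hs x hx).2)
  convert! hderiv using 1
  rw [setIntegral_congr_fun hΩ.isOpen.measurableSet fun x hx => hsol.mass_balance hs ht hx,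
    integral_neg, hΩ.integral_dvg_eq_zero, neg_zero]
  · exact (P.contDiff_ρ.comp_contDiffOn ((hsol.φ_space t ht).of_le (by norm_num))).smul
      ((hsol.v_space t ht).of_le (by norm_num))
  · intro x hx
    rw [hbc.v_bc t ht x hx, smul_zero]

theorem hasDerivAt_momentum (hsol : IsStrongSolution P Ω T φ v lam)
    (hbc : SatisfiesBoundaryConditions P Ω T φ v lam) (hΩ : IsBoundedLipschitzDomain Ω)
    {t : ℝ} (ht : t ∈ Ioo 0 T) :
    Integrable (momentumFlux P Ω (φ t) (v t) (lam t)) (surfaceMeasure Ω) ∧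
    HasDerivAt (fun s => ∫ x in Ω, P.ρ (φ s x) • v s x)
      (-∫ x, momentumFlux P Ω (φ t) (v t) (lam t) x ∂(surfaceMeasure Ω)) t := by
  have hs := hΩ.uniqueDiffOn
  have hG : ∀ w, ContDiffOn ℝ 1 (momentumTensor P Ω (φ t) (v t) (lam t) w) (closure Ω) :=
    contDiffOn_momentumTensor hs (hsol.φ_space t ht) (hsol.v_space t ht) (hsol.lam_space t ht)
  have hv : ContDiffOn ℝ 1 (v t) (closure Ω) := (hsol.v_space t ht).of_le (by norm_num)
  have hm : ContDiffOn ℝ 1 (fun y => P.ρ (φ t y) • v t y) (closure Ω) :=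
    (P.contDiff_ρ.comp_contDiffOn ((hsol.φ_space t ht).of_le (by norm_num))).smul hv
  have hmv : ∀ i : Fin d,
      ContDiffOn ℝ 1 (fun y => (P.ρ (φ t y) • v t y) i • v t y) (closure Ω) := fun i =>
    ((EuclideanSpace.proj i : Space d →L[ℝ] ℝ).contDiff.comp_contDiffOn hm).smul hv
  have hgauss := fun i : Fin d => hΩ.integral_fderivWithin_vector
    (hG (EuclideanSpace.single i 1)) (EuclideanSpace.single i 1)
  have hflux : (fun x => ∑ i, (inner ℝ (EuclideanSpace.single i (1 : ℝ)) (outerNormal Ω x) : ℝ)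
        • momentumTensor P Ω (φ t) (v t) (lam t) (EuclideanSpace.single i 1) x)
      =ᵐ[surfaceMeasure Ω] momentumFlux P Ω (φ t) (v t) (lam t) := by
    filter_upwards [ae_restrict_mem isClosed_frontier.measurableSet] with x hx
    exact sum_inner_smul_momentumTensor (hbc.φ_bc t ht x hx)
  refine ⟨(integrable_finsetSum _ fun i _ => (hgauss i).1).congr hflux, ?_⟩
  obtain ⟨C, hC, hev⟩ := hΩ.exists_local_bound (fun t ht => (hsol.φ_space t ht).continuousOn)
    hsol.φ_time hsol.φ_time_cont ht
  obtain ⟨C', hC', hev'⟩ := hΩ.exists_local_bound (fun t ht => (hsol.v_space t ht).continuousOn)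
    hsol.v_time hsol.v_time_cont ht
  obtain ⟨δ, ⟨⟨hδT, hb⟩, -, hb'⟩, hδ⟩ := ((hev.and hev').and self_mem_nhdsWithin).exists
  have hρcont : ∀ s ∈ Ioo 0 T, ContinuousOn (fun x => P.ρ (φ s x)) (closure Ω) := fun s hs =>
    P.contDiff_ρ.continuous (n := 0) |>.comp_continuousOn (hsol.φ_space s hs).continuousOn
  have hφt : ∀ s ∈ Ioo 0 T, ∀ x ∈ closure Ω, HasDerivAt (fun r => φ r x)
      (deriv (fun r => φ r x) s) s := fun s hs x hx =>
    ((hsol.φ_time x hx).differentiableAt (isOpen_Ioo.mem_nhds hs)).hasDerivAt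
  have hvt : ∀ s ∈ Ioo 0 T, ∀ x ∈ closure Ω, HasDerivAt (fun r => v r x)
      (deriv (fun r => v r x) s) s := fun s hs x hx =>
    ((hsol.v_time x hx).differentiableAt (isOpen_Ioo.mem_nhds hs)).hasDerivAt
  have hρt : ∀ s ∈ Ioo 0 T, ∀ x ∈ closure Ω, HasDerivAt (fun r => P.ρ (φ r x))
      ((P.ρ₁ - P.ρ₂) / 2 * deriv (fun r => φ r x) s) s := fun s hs x hx => by
    simp_rw [P.ρ_eq]
    exact ((hφt s hs x hx).const_mul _).const_add _
  have hderiv := hΩ.hasDerivAt_integral (u := fun s x => P.ρ (φ s x) • v s x)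
    (u' := fun s x => ((P.ρ₁ - P.ρ₂) / 2 * deriv (fun r => φ r x) s) • v s x
      + P.ρ (φ s x) • deriv (fun r => v r x) s)
    (C := |(P.ρ₁ - P.ρ₂) / 2| * C * C'
      + (|(P.ρ₁ + P.ρ₂) / 2| + |(P.ρ₁ - P.ρ₂) / 2| * C) * C') hδ
    (fun s hs => (hρcont s (hδT hs)).smul (hsol.v_space s (hδT hs)).continuousOn)
    (fun s hs x hx => by
      rw [add_comm]
      exact (hρt s (hδT hs) x hx).smul (hvt s (hδT hs) x hx))
    (((continuousOn_const.mul (hsol.φ_time_cont.comp (Continuous.prodMk_right t).continuousOn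
      fun x hx => ⟨ht, hx⟩)).smul hv.continuousOn).add ((hρcont t ht).smul
      (hsol.v_time_cont.comp (Continuous.prodMk_right t).continuousOn fun x hx => ⟨ht, hx⟩)))
    (fun s hs x hx => by
      obtain ⟨h1, h2⟩ := hb s hs x hx
      obtain ⟨h3, h4⟩ := hb' s hs x hx
      refine (norm_add_le _ _).trans ?_
      rw [norm_smul, norm_smul, norm_mul, Real.norm_eq_abs ((P.ρ₁ - P.ρ₂) / 2), P.ρ_eq]
      have h5 : ‖(P.ρ₁ + P.ρ₂) / 2 + (P.ρ₁ - P.ρ₂) / 2 * φ s x‖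
          ≤ |(P.ρ₁ + P.ρ₂) / 2| + |(P.ρ₁ - P.ρ₂) / 2| * C := by
        refine (norm_add_le _ _).trans ?_
        rw [norm_mul, Real.norm_eq_abs, Real.norm_eq_abs ((P.ρ₁ - P.ρ₂) / 2)]
        gcongr
      gcongr)
  convert! hderiv using 1
  have hi1 : ∀ i : Fin d, IntegrableOn (fun x => fderivWithin ℝ
      (fun y => (P.ρ (φ t y) • v t y) i • v t y) (closure Ω) x (EuclideanSpace.single i 1)) Ω :=
    fun i => hΩ.integrableOn (hΩ.continuousOn_fderivWithin (hmv i) _)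
  have hi2 : ∀ i : Fin d, IntegrableOn (fun x => fderivWithin ℝ
      (momentumTensor P Ω (φ t) (v t) (lam t) (EuclideanSpace.single i 1)) (closure Ω) x
      (EuclideanSpace.single i 1)) Ω :=
    fun i => hΩ.integrableOn (hΩ.continuousOn_fderivWithin (hG _) _)
  have hi : ∀ i : Fin d, IntegrableOn (fun x => fderivWithin ℝ
        (fun y => (P.ρ (φ t y) • v t y) i • v t y) (closure Ω) x (EuclideanSpace.single i 1)
      + fderivWithin ℝ (momentumTensor P Ω (φ t) (v t) (lam t) (EuclideanSpace.single i 1))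
        (closure Ω) x (EuclideanSpace.single i 1)) Ω := fun i => (hi1 i).add (hi2 i)
  rw [setIntegral_congr_fun hΩ.isOpen.measurableSet
      fun x hx => hsol.momentum_balance hΩ.isOpen hs ht hx, integral_neg,
    integral_finsetSum _ fun i _ => hi i, ← integral_congr_ae hflux,
    integral_finsetSum _ fun i _ => (hgauss i).1]
  congr 1
  refine Finset.sum_congr rfl fun i _ => ?_
  -- The convective flux has no boundary contribution because `v = 0` there; only the tensor flux
  -- survives.
  rw [integral_add (hi1 i) (hi2 i), (hgauss i).2, hΩ.integral_fderivWithin_eq_zero (hmv i), zero_add]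
  intro x hx
  rw [hbc.v_bc t ht x hx, smul_zero]

end IsStrongSolution

end QuasiIncompressible

end

theorem mainTheorem8 {d : ℕ} (hd : 1 ≤ d)
    (P : QuasiIncompressible.Parameters)
    (Ω : Set (QuasiIncompressible.Space d))
    (hΩ : QuasiIncompressible.IsBoundedLipschitzDomain Ω) (T : ℝ)
    (φ : ℝ → QuasiIncompressible.Space d → ℝ)
    (v : ℝ → QuasiIncompressible.Space d → QuasiIncompressible.Space d)
    (lam : ℝ → QuasiIncompressible.Space d → ℝ)
    (hsol : QuasiIncompressible.IsStrongSolution P Ω T φ v lam)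
    (hbc : QuasiIncompressible.SatisfiesBoundaryConditions P Ω T φ v lam) :
    (∀ t ∈ Set.Ioo 0 T,
      MeasureTheory.IntegrableOn (fun x => P.ρ (φ t x)) Ω ∧
      HasDerivAt (fun s => ∫ x in Ω, P.ρ (φ s x)) 0 t) ∧
    (∀ t ∈ Set.Ioo 0 T,
      MeasureTheory.IntegrableOn (fun x => P.ρ (φ t x) • v t x) Ω ∧
      MeasureTheory.Integrable (QuasiIncompressible.momentumFlux P Ω (φ t) (v t) (lam t))
        (QuasiIncompressible.surfaceMeasure Ω) ∧
      HasDerivAt (fun s => ∫ x in Ω, P.ρ (φ s x) • v s x)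
        (-∫ x, QuasiIncompressible.momentumFlux P Ω (φ t) (v t) (lam t) x
          ∂(QuasiIncompressible.surfaceMeasure Ω)) t) := by
  refine ⟨fun t ht => ⟨?_, hsol.hasDerivAt_mass hbc hΩ ht⟩, fun t ht => ⟨?_, ?_⟩⟩
  · exact hΩ.integrableOn
      (P.contDiff_ρ.continuous (n := 0) |>.comp_continuousOn (hsol.φ_space t ht).continuousOn)
  · exact hΩ.integrableOn
      ((P.contDiff_ρ.continuous (n := 0) |>.comp_continuousOn (hsol.φ_space t ht).continuousOn).smul
        (hsol.v_space t ht).continuousOn)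
  · exact hsol.hasDerivAt_momentum hbc hΩ ht
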